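/- **Fourth-order consistency of the D$d$Q$(2d^2+1)$ MRT lattice Boltzmann scheme.** Let $d\ge 1$ and consider the diagonal-anisotropic diffusion equation $$\partial_t\phi=\sum_{i=1}^d\kappa_{i}\,\partial_{x_i}^2\phi+\eta\phi+S,\qquad \kappa_i,\eta,S\in\mathbb R .$$ *Scheme.* Let $\Delta t=\xi\Delta x^2$ with a fixed $\xi>0$, and $c=\Delta x/\Delta t$. The $q=2d^2+1$ unit velocities $\mathbf e_k$ are $0$, $\pm\mathbf e_i$ ($1\le i\le d$) and $\pm\mathbf e_i\pm\mathbf e_j$ ($i<j$), and $\mathbf c_k=c\,\mathbf e_k$. The weights, all in $(0,1)$, are $\omega_i$ for $\pm\mathbf e_i$, a common $\tilde\omega$ for all $\pm\mathbf e_i\pm\mathbf e_j$, and $1-2\sum_i\omega_i-2d(d-1)\tilde\omega$ for $0$; below, $\omega_{(k)}$ denotes the weight of $\mathbf e_k$. The rows of $\mathbf M$ are the monomials $1,\ X_i,\ X_i^2,\ X_iX_j,\ X_i^2X_j,\ X_iX_j^2,\ X_i^2X_j^2$ ($i<j$) evaluated at the $\mathbf c_k$; $\mathbf S$ is the diagonal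 matrix of the corresponding nonzero relaxation parameters $s_0$, $s_{x_i}\in(0,2)$, $s_{2|x_i^2}$, $s_{2|x_ix_j}$, $s_{3|x_i^2x_j}$, $s_{3|x_ix_j^2}$, $s_{4|x_i^2x_j^2}$; and $\Lambda=\mathbf M^{-1}\mathbf S\mathbf M$. The scheme is $$f_k(\mathbf x+\mathbf c_k\Delta t,t+\Delta t)=f_k-\sum_i\Lambda_{ki}\big(f_i-\omega_{(i)}\phi\big)+\Delta t\sum_i\Big(\mathbf I-\frac{\Lambda}{2}\Big)_{ki}\omega_{(i)}(\eta\phi+S),\qquad \phi=\frac{2\sum_kf_k+\Delta t\,S}{2-\Delta t\,\eta},$$ with the right-hand side evaluated at $(\mathbf x,t)$. The parameters are independent of $\Delta x$, except $s_{x_i}$ (see (1)) and $s_{3|x_i^2x_j}=\tilde s_{3|x_i^2x_j}+O(\Delta x^2)$ ($i\ne j$), where $\tilde s_{3|x_i^2x_j}\neq0$ is constant. *Conditions.* Let $\tilde s_{i}\ne0$ be constants and put $A_i=2\omega_i+4(d-1)\tilde\omega$, $\tilde\epsilon_i=(1/\tilde s_i-1/2)A_i$, $E^{(2)}_i=e_2(\tilde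 s_i,s_{2|x_i^2})$, $$e_1(a,b,g)=-\frac7{24}+\frac1{6a}+\Big(\frac1{gb}-\frac1{2g}-\frac1{2b}\Big)\Big(\frac1a-1\Big)-\Big(\frac12-\frac1{2b}\Big)\Big(\frac1g-\frac12\Big)+\frac1{6g},$$ $$e_2(a,b)=\Big(\frac1a-1\Big)\Big(1-\frac1b-\frac1a\Big)+\frac12-\frac1{2b},$$ $E^{(1)}_{i|\beta|i^3}=e_1(\tilde s_i,s_{2|\beta},\tilde s_i)$ and $E^{(1)}_{i|\beta|\gamma}=e_1(\tilde s_i,s_{2|\beta},\tilde s_{3|\gamma})$ for mixed $\gamma$ (subscripts abbreviate monomials: $i^2j$ stands for $x_i^2x_j$). The $3d+d(d-1)/2=(d^2+5d)/2$ conditions are, for all sufficiently small $\Delta x>0$ (that is, for $0<\Delta x<h_0$), 1. $s_{x_i}=\dfrac{2\eta\Delta t}{\Delta t\,\eta-\sqrt{(\tilde s_i-4\Delta t\,\eta+\Delta t^2\tilde s_i\eta^2+2\Delta t\,\tilde s_i\eta)/\tilde s_i}+1}$ for all $i$, with a nonnegative radicand (for $\eta=0$ this is read as its limit $s_{x_i}=\tilde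 s_i$); 2. $\tilde\epsilon_i=\kappa_i\xi$ for all $i$; 3. $\frac{\tilde\epsilon_i}2\big(\frac1{\tilde s_i}-\frac12\big)=E^{(1)}_{i|i^2|i^3}+E^{(2)}_i\tilde\epsilon_i$ for all $i$; 4. $\tilde\epsilon_i\tilde\epsilon_j=4\big(E^{(1)}_{i|i^2|i^2j}+E^{(1)}_{j|j^2|ij^2}+E^{(1)}_{i|ij|i^2j}+E^{(1)}_{j|ij|ij^2}+E^{(1)}_{i|ij|ij^2}+E^{(1)}_{j|ij|i^2j}\big)\tilde\omega+E^{(2)}_i\tilde\epsilon_jA_i+E^{(2)}_j\tilde\epsilon_iA_j$ for all $i<j$. *Truncation errors.* $$\mathrm{Err}_{0,i}=\Big(\frac1{s_{x_i}}-\frac12\Big)A_i+\frac{\Delta t}{s_{x_i}}\Big(1-\frac1{s_{x_i}}\Big)\eta A_i-\kappa_i\xi,$$ $$\begin{aligned}\mathrm{Err}_2[\phi]=\Delta x^2\Big(&-\frac\xi2\sum_{i,j}\kappa_i\kappa_j\partial_i^2\partial_j^2\phi+\frac1\xi\sum_iE^{(1)}_{i|i^2|i^3}A_i\partial_i^4\phi+\frac4\xi\sum_{i\ne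 j}\big(E^{(1)}_{i|i^2|i^2j}+E^{(1)}_{i|ij|i^2j}+E^{(1)}_{i|ij|ij^2}\big)\tilde\omega\,\partial_i^2\partial_j^2\phi\\&+\sum_{i\neq j}E^{(2)}_i\kappa_jA_i\partial_i^2\partial_j^2\phi+\sum_iE^{(2)}_i\kappa_iA_i\partial_i^4\phi\Big).\end{aligned}$$ *Claim.* Consider any $T$ and any family (indexed by $0<\Delta x<h_0$) of smooth functions $f_k$ on $\mathbb R^d\times(0,T)$ whose derivatives of each order are bounded uniformly in $\Delta x$, and which satisfy the scheme at all $(\mathbf x,t)$ with $0<t<t+\Delta t<T$. Let $\phi$ be its macroscopic variable. (a) If (1) and (2) hold, then $\mathrm{Err}_{0,i}=0$ for all $i$ and all $0<\Delta x<h_0$, and the modified equation $$\partial_t\phi=\sum_i\kappa_i\partial_{x_i}^2\phi+\eta\phi+S+\frac1\xi\sum_i\mathrm{Err}_{0,i}\,\partial_{x_i}^2\phi+\mathrm{Err}_2[\phi]+O(\Delta x^4)\qquad(\Delta x\to0)$$ holds uniformly in $\{(\mathbf x,t):0<t<t+\Delta t<T\}$. (b) If (1)–(4) hold, then moreover $\mathrm{Err}_2$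 vanishes on every smooth function, and the scheme is fourth-order consistent with the diffusion equation: uniformly in the same region, $$\partial_t\phi=\sum_i\kappa_i\partial_{x_i}^2\phi+\eta\phi+S+O(\Delta x^4).$$ -/

import Mathlib

noncomputable section

namespace LBM

open Set Filter Topology

/-! ### The lattice -/

/-- Unordered pairs of distinct coordinate directions, listed as `i < j`. -/
abbrev Pairs (d : ℕ) := {p : Fin d × Fin d // p.1 < p.2}

/-- Index set with `2 * d ^ 2 + 1` elements. It labels both the discrete velocities and the
monomials of the natural transformation matrix (their numbering by `1, …, q` is immaterial). -/
abbrev Idx (d : ℕ) := Unit ⊕ (Fin d × Bool) ⊕ (Pairs d × Bool × Bool)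

theorem card_idx (d : ℕ) : Fintype.card (Idx d) = 2 * d ^ 2 + 1 := by
  have h : 2 * Fintype.card (Pairs d) + d = d ^ 2 := by
    have e1 : Fintype.card (Pairs d) = ∑ j : Fin d, (j : ℕ) := by
      rw [Fintype.card_subtype, Finset.card_filter, Fintype.sum_prod_type_right]
      refine Finset.sum_congr rfl fun j _ => ?_
      rw [← Finset.card_filter, ← Fin.card_Iio j]
      congr 1
      ext x
      simp
    rw [e1, Fin.sum_univ_eq_sum_range (fun i => i) d]
    have := Finset.sum_range_id_mul_two d
    rcases d with _ | d
    · simp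
    · simp only [Nat.add_sub_cancel] at this
      nlinarith
  simp only [Fintype.card_sum, Fintype.card_prod, Fintype.card_unit, Fintype.card_bool,
    Fintype.card_fin]
  omega

/-- `+1` or `-1`. -/
def sgn (b : Bool) : ℝ := if b then 1 else -1

/-- The unit velocities `e_k` of the D`d`Q`(2d²+1)` lattice: `0`, `± e_i`, and `± e_i ± e_j`
for `i < j`. -/
def unitVel {d : ℕ} : Idx d → Fin d → ℝ
  | .inl _ => 0
  | .inr (.inl (i, b)) => Pi.single i (sgn b)
  | .inr (.inr (p, b, b')) => Pi.single p.1.1 (sgn b) + Pi.single p.1.2 (sgn b')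

/-- `1` or `2`. -/
def pw (b : Bool) : ℕ := if b then 2 else 1

/-- Exponents of the monomials `1`, `X_i`, `X_i²`, and `X_i X_j`, `X_i² X_j`, `X_i X_j²`,
`X_i² X_j²` for `i < j`, which define the rows of the transformation matrix. -/
def expo {d : ℕ} : Idx d → Fin d → ℕ
  | .inl _ => 0
  | .inr (.inl (i, b)) => Pi.single i (pw b)
  | .inr (.inr (p, b, b')) => Pi.single p.1.1 (pw b) + Pi.single p.1.2 (pw b')

/-- The transformation matrix: row `m` is the monomial `m` evaluated at the discrete velocities
`c_k = c e_k`, where `c` is the lattice speed. -/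
def transf (d : ℕ) (c : ℝ) : Matrix (Idx d) (Idx d) ℝ :=
  fun m k => ∏ l, (c * unitVel k l) ^ expo m l

/-! ### Parameters of the equation and of the scheme -/

/-- Data of the diffusion equation `∂_t φ = ∑ κ_i ∂_i² φ + η φ + S` and of the scheme. -/
structure Params (d : ℕ) where
  /-- diffusion coefficients `κ_{x_i}` -/
  κ : Fin d → ℝ
  /-- linear source coefficient -/
  η : ℝ
  /-- constant source -/
  S : ℝ
  /-- the ratio `Δt / Δx²` -/
  ξ : ℝ
  /-- axis weights `ω_i`, common to the velocities `± e_i` -/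
  w : Fin d → ℝ
  /-- the common weight of all diagonal velocities -/
  wd : ℝ
  /-- relaxation parameter `s_0` -/
  s0 : ℝ
  /-- relaxation parameters `s_{x_i}`, which depend on `Δx` -/
  sx : ℝ → Fin d → ℝ
  /-- relaxation parameters `s_{2|x_i x_j}`, including `s_{2|x_i²}` -/
  s2 : Sym2 (Fin d) → ℝ
  /-- relaxation parameters `s_{3|x_i² x_j}` (`i ≠ j`), possibly depending on `Δx` -/
  s3 : ℝ → Fin d → Fin d → ℝ
  /-- relaxation parameters `s_{4|x_i² x_j²}` (`i ≠ j`) -/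
  s4 : Sym2 (Fin d) → ℝ
  /-- the constants written `s̃_{x_i}` -/
  sxt : Fin d → ℝ
  /-- the constants written `s̃_{3|x_i² x_j}` (`i ≠ j`) -/
  s3t : Fin d → Fin d → ℝ

namespace Params

variable {d : ℕ} (P : Params d)

/-- Diffusive scaling `Δt = ξ Δx²`. -/
def dt (Δx : ℝ) : ℝ := P.ξ * Δx ^ 2

/-- Lattice speed `c = Δx / Δt`. -/
def speed (Δx : ℝ) : ℝ := Δx / P.dt Δx

/-- Discrete velocities `c_k`. -/
def vel (Δx : ℝ) (k : Idx d) : Fin d → ℝ := P.speed Δx • unitVel k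

/-- All weights. -/
def weight : Idx d → ℝ
  | .inl _ => 1 - 2 * ∑ i, P.w i - 2 * d * (d - 1) * P.wd
  | .inr (.inl (i, _)) => P.w i
  | .inr (.inr _) => P.wd

/-- Diagonal of the relaxation matrix: one parameter for each monomial. -/
def relax (Δx : ℝ) : Idx d → ℝ
  | .inl _ => P.s0
  | .inr (.inl (i, false)) => P.sx Δx i
  | .inr (.inl (i, true)) => P.s2 s(i, i)
  | .inr (.inr (p, false, false)) => P.s2 s(p.1.1, p.1.2)
  | .inr (.inr (p, true, false)) => P.s3 Δx p.1.1 p.1.2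
  | .inr (.inr (p, false, true)) => P.s3 Δx p.1.2 p.1.1
  | .inr (.inr (p, true, true)) => P.s4 s(p.1.1, p.1.2)

/-- The collision matrix `Λ = M⁻¹ S M`. -/
def collision (Δx : ℝ) : Matrix (Idx d) (Idx d) ℝ :=
  (transf d (P.speed Δx))⁻¹ * Matrix.diagonal (P.relax Δx) * transf d (P.speed Δx)

/-- Standing assumptions on the parameters, for mesh sizes `0 < Δx < h₀`: weights in `(0,1)`,
`s_{x_i}` in `(0,2)`, the other relaxation parameters nonzero (so that `Λ` is invertible), and
`s_{3|x_i² x_j} = s̃_{3|x_i² x_j} + O(Δx²)` with nonzero constants `s̃`. -/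
structure Admissible (h₀ : ℝ) : Prop where
  h₀_pos : 0 < h₀
  ξ_pos : 0 < P.ξ
  weight_mem : ∀ k, P.weight k ∈ Ioo (0 : ℝ) 1
  s0_ne : P.s0 ≠ 0
  sx_mem : ∀ Δx ∈ Ioo 0 h₀, ∀ i, P.sx Δx i ∈ Ioo (0 : ℝ) 2
  s2_ne : ∀ i j, P.s2 s(i, j) ≠ 0
  s3_ne : ∀ Δx ∈ Ioo 0 h₀, ∀ i j, i ≠ j → P.s3 Δx i j ≠ 0
  s4_ne : ∀ i j, i ≠ j → P.s4 s(i, j) ≠ 0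
  sxt_ne : ∀ i, P.sxt i ≠ 0
  s3t_ne : ∀ i j, i ≠ j → P.s3t i j ≠ 0
  s3_sub : ∀ i j, i ≠ j →
    (fun Δx => P.s3 Δx i j - P.s3t i j) =O[𝓝[>] (0 : ℝ)] fun Δx => Δx ^ 2

/-! ### The scheme -/

/-- The macroscopic variable `φ = (2 ∑ f_k + Δt S) / (2 - Δt η)`; `g k` is the distribution
function at mesh size `Δx`. -/
def macro_ (Δx : ℝ) (g : Idx d → (Fin d → ℝ) × ℝ → ℝ) (z : (Fin d → ℝ) × ℝ) : ℝ :=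
  (2 * ∑ k, g k z + P.dt Δx * P.S) / (2 - P.dt Δx * P.η)

/-- The evolution equation of the scheme at the space-time point `(x, t)`, with
`f_k^eq = ω_k φ` and `R_k = ω_k (η φ + S)`. -/
def SchemeAt (Δx : ℝ) (g : Idx d → (Fin d → ℝ) × ℝ → ℝ) (x : Fin d → ℝ) (t : ℝ) : Prop :=
  ∀ k, g k (x + P.dt Δx • P.vel Δx k, t + P.dt Δx) =
    g k (x, t)
      - ∑ i, P.collision Δx k i * (g i (x, t) - P.weight i * P.macro_ Δx g (x, t))
      + P.dt Δx * ∑ i, ((1 : Matrix (Idx d) (Idx d) ℝ) - (1 / 2 : ℝ) • P.collision Δx) k i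
          * (P.weight i * (P.η * P.macro_ Δx g (x, t) + P.S))

end Params

/-- The open space-time slab `ℝ^d × (0, T)`. -/
def slab (d : ℕ) (T : ℝ) : Set ((Fin d → ℝ) × ℝ) := {z | z.2 ∈ Ioo 0 T}

/-- Time derivative. -/
def dT {d : ℕ} (u : (Fin d → ℝ) × ℝ → ℝ) (z : (Fin d → ℝ) × ℝ) : ℝ := fderiv ℝ u z (0, 1)

/-- Partial derivative in the `i`-th space direction. -/
def dX {d : ℕ} (i : Fin d) (u : (Fin d → ℝ) × ℝ → ℝ) (z : (Fin d → ℝ) × ℝ) : ℝ :=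
  fderiv ℝ u z (Pi.single i 1, 0)

namespace Params

variable {d : ℕ} (P : Params d)

/-- A family, indexed by the mesh size, of smooth solutions of the scheme on `ℝ^d × (0, T)` whose
derivatives of every order are bounded uniformly in the mesh size. -/
structure IsSolutionFamily (h₀ T : ℝ) (f : ℝ → Idx d → (Fin d → ℝ) × ℝ → ℝ) : Prop where
  smooth : ∀ Δx ∈ Ioo 0 h₀, ∀ k, ContDiffOn ℝ (⊤ : ℕ∞) (f Δx k) (slab d T)
  bounded : ∀ n : ℕ, ∃ C : ℝ, ∀ Δx ∈ Ioo 0 h₀, ∀ k, ∀ z ∈ slab d T,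
    ‖iteratedFDeriv ℝ n (f Δx k) z‖ ≤ C
  scheme : ∀ Δx ∈ Ioo 0 h₀, ∀ x t, 0 < t → t + P.dt Δx < T → P.SchemeAt Δx (f Δx) x t

/-- `∂_t φ - ∑ κ_i ∂_i² φ - (η φ + S)`. -/
def residual (φ : (Fin d → ℝ) × ℝ → ℝ) (z : (Fin d → ℝ) × ℝ) : ℝ :=
  dT φ z - ∑ i, P.κ i * dX i (dX i φ) z - (P.η * φ z + P.S)

/-- `∂_t φ = ∑ κ_i ∂_i² φ + η φ + S + E_{Δx}[φ] + O(Δx⁴)` is a modified equation of the scheme: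
it holds, uniformly in space and time, for the macroscopic variable of every family of smooth
solutions of the scheme. -/
def HasModifiedEquation (h₀ : ℝ)
    (E : ℝ → ((Fin d → ℝ) × ℝ → ℝ) → (Fin d → ℝ) × ℝ → ℝ) : Prop :=
  ∀ (T : ℝ) (f : ℝ → Idx d → (Fin d → ℝ) × ℝ → ℝ), P.IsSolutionFamily h₀ T f →
    ∃ C : ℝ, ∀ᶠ Δx in 𝓝[>] (0 : ℝ), ∀ x t, 0 < t → t + P.dt Δx < T →
      |P.residual (P.macro_ Δx (f Δx)) (x, t) - E Δx (P.macro_ Δx (f Δx)) (x, t)| ≤ C * Δx ^ 4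

/-- The modified equation of the scheme is the diffusion equation itself, up to `O(Δx⁴)`. -/
def FourthOrderConsistent (h₀ : ℝ) : Prop := P.HasModifiedEquation h₀ fun _ _ _ => 0

/-! ### Truncation errors -/

/-- Second moment `2 ω_i + 4 (d - 1) ω̃` of the weights. -/
def A (i : Fin d) : ℝ := 2 * P.w i + 4 * (d - 1) * P.wd

/-- `ε̃_{x_i} = (1 / s̃_{x_i} - 1 / 2) (2 ω_i + 4 (d - 1) ω̃)`. -/
def epst (i : Fin d) : ℝ := (1 / P.sxt i - 1 / 2) * P.A i

/-- Zeroth-order truncation error. -/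
def err0 (Δx : ℝ) (i : Fin d) : ℝ :=
  (1 / P.sx Δx i - 1 / 2) * P.A i
    + P.dt Δx / P.sx Δx i * (1 - 1 / P.sx Δx i) * P.η * P.A i - P.κ i * P.ξ

end Params

/-- The coefficient `err^(1)` as a function of `s̃_α`, `s_{2|β}` and `s_{3|γ}`. -/
def e1 (a b g : ℝ) : ℝ :=
  -7 / 24 + 1 / (6 * a) + (1 / (g * b) - 1 / (2 * g) - 1 / (2 * b)) * (1 / a - 1)
    - (1 / 2 - 1 / (2 * b)) * (1 / g - 1 / 2) + 1 / (6 * g)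

/-- The coefficient `err^(2)` as a function of `s̃_α` and `s_{2|α²}`. -/
def e2 (a b : ℝ) : ℝ := (1 / a - 1) * (1 - 1 / b - 1 / a) + 1 / 2 - 1 / (2 * b)

/-- The fourth derivative `∂_i² ∂_j²`. -/
def dX4 {d : ℕ} (i j : Fin d) (u : (Fin d → ℝ) × ℝ → ℝ) : (Fin d → ℝ) × ℝ → ℝ :=
  dX i (dX i (dX j (dX j u)))

namespace Params

variable {d : ℕ} (P : Params d)

/-- Second-order truncation error. -/
def err2 (Δx : ℝ) (φ : (Fin d → ℝ) × ℝ → ℝ) (z : (Fin d → ℝ) × ℝ) : ℝ :=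
  Δx ^ 2 *
    (-(P.ξ / 2) * ∑ i, ∑ j, P.κ i * P.κ j * dX4 i j φ z
      + 1 / P.ξ * ∑ i, e1 (P.sxt i) (P.s2 s(i, i)) (P.sxt i) * P.A i * dX4 i i φ z
      + 4 / P.ξ * ∑ i, ∑ j, (if i = j then 0 else
          (e1 (P.sxt i) (P.s2 s(i, i)) (P.s3t i j) + e1 (P.sxt i) (P.s2 s(i, j)) (P.s3t i j)
            + e1 (P.sxt i) (P.s2 s(i, j)) (P.s3t j i)) * P.wd * dX4 i j φ z)
      + ∑ i, ∑ j, (if i = j then 0 else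
          e2 (P.sxt i) (P.s2 s(i, i)) * P.κ j * P.A i * dX4 i j φ z)
      + ∑ i, e2 (P.sxt i) (P.s2 s(i, i)) * P.κ i * P.A i * dX4 i i φ z)

/-- Total truncation error: the zeroth-order and the second-order part. -/
def truncation (Δx : ℝ) (φ : (Fin d → ℝ) × ℝ → ℝ) (z : (Fin d → ℝ) × ℝ) : ℝ :=
  1 / P.ξ * ∑ i, P.err0 Δx i * dX i (dX i φ) z + P.err2 Δx φ z

/-! ### The four families of conditions -/

/-- The expression under the square root in the first condition. -/
def radicand (Δx : ℝ) (i : Fin d) : ℝ :=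
  (P.sxt i - 4 * P.dt Δx * P.η + P.dt Δx ^ 2 * P.sxt i * P.η ^ 2
    + 2 * P.dt Δx * P.sxt i * P.η) / P.sxt i

/-- First condition. For `η = 0` the fraction takes the form `0 / 0` and is read as its
limit `s̃_{x_i}` as `η → 0`. -/
def Cond1 (h₀ : ℝ) : Prop :=
  ∀ Δx ∈ Ioo 0 h₀, ∀ i, 0 ≤ P.radicand Δx i ∧
    P.sx Δx i = if P.η = 0 then P.sxt i else
      2 * P.η * P.dt Δx / (P.dt Δx * P.η - √(P.radicand Δx i) + 1)

/-- Second condition. -/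
def Cond2 : Prop := ∀ i, P.epst i = P.κ i * P.ξ

/-- Third condition. -/
def Cond3 : Prop :=
  ∀ i, P.epst i / 2 * (1 / P.sxt i - 1 / 2) =
    e1 (P.sxt i) (P.s2 s(i, i)) (P.sxt i) + e2 (P.sxt i) (P.s2 s(i, i)) * P.epst i

/-- Fourth condition. -/
def Cond4 : Prop :=
  ∀ i j, i < j → P.epst i * P.epst j =
    4 * (e1 (P.sxt i) (P.s2 s(i, i)) (P.s3t i j) + e1 (P.sxt j) (P.s2 s(j, j)) (P.s3t j i)
        + e1 (P.sxt i) (P.s2 s(i, j)) (P.s3t i j) + e1 (P.sxt j) (P.s2 s(i, j)) (P.s3t j i)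
        + e1 (P.sxt i) (P.s2 s(i, j)) (P.s3t j i) + e1 (P.sxt j) (P.s2 s(i, j)) (P.s3t i j))
        * P.wd
      + e2 (P.sxt i) (P.s2 s(i, i)) * P.epst j * P.A i
      + e2 (P.sxt j) (P.s2 s(j, j)) * P.epst i * P.A j

end Params

end LBM

end

noncomputable section

namespace LBM

/-! Each row of the transformation matrix is a left eigenvector of the collision matrix. Hence every
moment of the distributions equals its equilibrium value plus a source term minus `1 / s_m` times
the same moment of "translated minus untranslated" distributions (`scheme_moment`). With `h = Δx`,
Taylor expansion replaces translation by a polynomial in `∂_i`, `∂_t` up to `h ^ 6` times a bounded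
family (`Fam.shift_eq_taylor`). So the scheme becomes a linear system over a commutative ring of
differential operators, acting on families with uniformly bounded derivatives modulo `h ^ 6`
(`SchemeFam.toMomentSystem`).

That system is solved by pure algebra in `MomentSystem`. On the lattice `X_i ^ 3 = X_i` and products
of three distinct coordinates vanish, so few monomials occur. Odd moments have no equilibrium part,
by reflection symmetry, and are therefore multiples of `h`. Starting from this, the relations are
fed into themselves, and each pass determines moments to one more order. Inserting the first moments
into mass conservation yields `conservation_expansion`. Its `h ^ 4` terms still contain `∂_t`, which
the leading-order equation `h4_τ` removes; this gives `modified_equation`. Every term there carries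
a factor `h ^ 2`, and dividing it out leaves an error of order `h ^ 4`.

Condition (1) says that `1 / s_{x_i}` is a root of a quadratic whose correction to `1 / s̃_i`
cancels all terms with `η` at order `h ^ 4` (`inv_sx_eq`, `h2_g`); condition (2) identifies the
diffusion operator. Finally `∂_i² ∂_j²` is symmetric in `i` and `j`, so only the symmetrised
coefficients matter, and their vanishing is conditions (3) and (4) (`sum_coef_eq_zero`). -/

/-- `0` on the diagonal and `1` off the diagonal. -/
def offDiag {d : ℕ} (i j : Fin d) : ℝ := if i = j then 0 else 1

/-- The moment equations of a lattice Boltzmann scheme modulo `h ^ 6`: `E` is the moment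
functional on an algebra of lattice functions generated by the coordinates `X i`, the differential
operators are elements of the ring `R`, and `τ` stands for `ξ ∂_t`. -/
structure MomentSystem (d : ℕ) (R Q L : Type*) [CommRing R] [Algebra ℝ R] [AddCommGroup Q]
    [Module R Q] [CommRing L] [Algebra R L] where
  E : L →ₗ[R] Q
  X : Fin d → L
  h : R
  τ : R
  del : Fin d → R
  φ : Q
  F : Q
  ξ : ℝ
  η : ℝ
  g : Fin d → Fin d → R
  gt : Fin d → Fin d → ℝ
  gr : Fin d → Fin d → R
  b : Fin d → Fin d → ℝ
  r4 : Fin d → Fin d → ℝ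
  W : Fin d → Fin d → ℝ
  D : L
  B : L
  C : L
  W_symm : ∀ i j, W i j = W j i
  h6 : ∀ q : Q, h ^ 6 • q = 0
  X_cube : ∀ i, X i ^ 3 = X i
  X_mul : ∀ i j l, i ≠ j → j ≠ l → i ≠ l → X i * X j * X l = 0
  D_eq : D = ∑ i, del i • X i
  B_eq : B = h • D + (h ^ 2 * τ) • 1 + ((1 / 2 : ℝ) • h ^ 2) • D ^ 2 + (h ^ 3 * τ) • D
    + ((1 / 6 : ℝ) • h ^ 3) • D ^ 3 + ((1 / 2 : ℝ) • (h ^ 4 * τ ^ 2)) • 1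
    + ((1 / 2 : ℝ) • (h ^ 4 * τ)) • D ^ 2 + ((1 / 24 : ℝ) • h ^ 4) • D ^ 4
    + ((1 / 2 : ℝ) • (h ^ 5 * τ ^ 2)) • D + ((1 / 6 : ℝ) • (h ^ 5 * τ)) • D ^ 3
    + ((1 / 120 : ℝ) • h ^ 5) • D ^ 5 + h ^ 6 • C
  rel_odd : ∀ i j, E (X i ^ 2 * X j) = -(g i j • E (X i ^ 2 * X j * B))
  rel_sq : ∀ i, E (X i ^ 2) = (W i i • (1 : R)) • φ + ((W i i * ξ * (b i i - 1 / 2)) • h ^ 2) • F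
    - (b i i • (1 : R)) • E (X i ^ 2 * B)
  rel_mixed : ∀ i j, i ≠ j → E (X i * X j) = -((b i j • (1 : R)) • E (X i * X j * B))
  rel_four : ∀ i j, i ≠ j → E (X i ^ 2 * X j ^ 2) = (W i j • (1 : R)) • φ
    + ((W i j * ξ * (r4 i j - 1 / 2)) • h ^ 2) • F - (r4 i j • (1 : R)) • E (X i ^ 2 * X j ^ 2 * B)
  cons : E B = (ξ • h ^ 2) • F
  mass : E 1 = φ - ((ξ / 2) • h ^ 2) • F
  g_eq : ∀ i j, g i j = gt i j • 1 + h ^ 2 * gr i j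
  gr_eq : ∀ i, gr i i = (ξ * η) • (g i i ^ 2 - g i i)
  del_F : ∀ i, del i • F = (η • del i) • φ

namespace MomentSystem

variable {d : ℕ} {R Q L : Type*} [CommRing R] [Algebra ℝ R] [AddCommGroup Q]
    [Module R Q] [CommRing L] [Algebra R L] (Z : MomentSystem d R Q L)

theorem E_mul_B (m : L) : Z.E (m * Z.B) = Z.h • Z.E (m * Z.D) + (Z.h ^ 2 * Z.τ) • Z.E m
    + ((1 / 2 : ℝ) • Z.h ^ 2) • Z.E (m * Z.D ^ 2) + (Z.h ^ 3 * Z.τ) • Z.E (m * Z.D)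
    + ((1 / 6 : ℝ) • Z.h ^ 3) • Z.E (m * Z.D ^ 3) + ((1 / 2 : ℝ) • (Z.h ^ 4 * Z.τ ^ 2)) • Z.E m
    + ((1 / 2 : ℝ) • (Z.h ^ 4 * Z.τ)) • Z.E (m * Z.D ^ 2)
    + ((1 / 24 : ℝ) • Z.h ^ 4) • Z.E (m * Z.D ^ 4)
    + ((1 / 2 : ℝ) • (Z.h ^ 5 * Z.τ ^ 2)) • Z.E (m * Z.D)
    + ((1 / 6 : ℝ) • (Z.h ^ 5 * Z.τ)) • Z.E (m * Z.D ^ 3)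
    + ((1 / 120 : ℝ) • Z.h ^ 5) • Z.E (m * Z.D ^ 5) + Z.h ^ 6 • Z.E (m * Z.C) := by
  conv_lhs => rw [Z.B_eq]
  simp only [mul_add, mul_smul_comm, map_add, map_smul, mul_one]

/-! ### Parity and the reduction of monomials -/

/-- The span of the odd monomials. -/
def oddPart : Submodule R L := Submodule.span R (Set.range fun p : Fin d × Fin d => Z.X p.1 ^ 2 * Z.X p.2)

theorem X_pow_four (i : Fin d) : Z.X i ^ 4 = Z.X i ^ 2 := by
  linear_combination Z.X i * Z.X_cube i

theorem X_sq_mul_mem (i j : Fin d) : Z.X i ^ 2 * Z.X j ∈ Z.oddPart :=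
  Submodule.subset_span ⟨(i, j), rfl⟩

theorem X_mul_X_sq_mem (i j : Fin d) : Z.X i * Z.X j ^ 2 ∈ Z.oddPart := by
  rw [mul_comm]; exact Z.X_sq_mul_mem j i

theorem X_mem (i : Fin d) : Z.X i ∈ Z.oddPart := by
  have := Z.X_sq_mul_mem i i
  rwa [← pow_succ, Z.X_cube] at this

theorem X_mul_X_mul_X_mem (i j l : Fin d) : Z.X i * Z.X j * Z.X l ∈ Z.oddPart := by
  by_cases hij : i = j
  · subst hij; rw [← sq]; exact Z.X_sq_mul_mem _ _
  by_cases hjl : j = l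
  · subst hjl; rw [mul_assoc, ← sq]; exact Z.X_mul_X_sq_mem _ _
  by_cases hil : i = l
  · subst hil
    have : Z.X i * Z.X j * Z.X i = Z.X i ^ 2 * Z.X j := by ring
    rw [this]; exact Z.X_sq_mul_mem _ _
  rw [Z.X_mul _ _ _ hij hjl hil]; exact zero_mem _

/-- Two extra coordinates preserve parity, and the lattice relations reduce the resulting
degree-five monomial to some `X_a ^ 2 * X_b` or to zero. This closure lets odd moments be discarded
without computing them. -/
theorem X_mul_X_mul_mem (a c : Fin d) {p : L} (hp : p ∈ Z.oddPart) :
    Z.X a * Z.X c * p ∈ Z.oddPart := by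
  induction hp using Submodule.span_induction with
  | zero => simp
  | add x y _ _ hx hy => rw [mul_add]; exact add_mem hx hy
  | smul r x _ hx => rw [mul_smul_comm]; exact Submodule.smul_mem _ _ hx
  | mem x hx =>
    obtain ⟨⟨i, j⟩, rfl⟩ := hx
    show Z.X a * Z.X c * (Z.X i ^ 2 * Z.X j) ∈ _
    by_cases hac : a = c
    · subst hac
      by_cases hai : a = i
      · subst hai
        have : Z.X a * Z.X a * (Z.X a ^ 2 * Z.X j) = Z.X a ^ 2 * Z.X j := by
          linear_combination Z.X j * Z.X_pow_four a
        rw [this]; exact Z.X_sq_mul_mem _ _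
      by_cases hja : j = a
      · subst hja
        have : Z.X j * Z.X j * (Z.X i ^ 2 * Z.X j) = Z.X i ^ 2 * Z.X j := by
          linear_combination Z.X i ^ 2 * Z.X_cube j
        rw [this]; exact Z.X_sq_mul_mem _ _
      by_cases hji : j = i
      · subst hji
        have : Z.X a * Z.X a * (Z.X j ^ 2 * Z.X j) = Z.X a ^ 2 * Z.X j := by
          linear_combination Z.X a ^ 2 * Z.X_cube j
        rw [this]; exact Z.X_sq_mul_mem _ _
      have : Z.X a * Z.X a * (Z.X i ^ 2 * Z.X j) = 0 := by
        linear_combination Z.X a * Z.X i * Z.X_mul a i j hai (Ne.symm hji) (Ne.symm hja)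
      rw [this]; exact zero_mem _
    by_cases hai : a = i
    · subst hai
      have : Z.X a * Z.X c * (Z.X a ^ 2 * Z.X j) = Z.X a * Z.X c * Z.X j := by
        linear_combination Z.X c * Z.X j * Z.X_cube a
      rw [this]; exact Z.X_mul_X_mul_X_mem _ _ _
    by_cases hci : c = i
    · subst hci
      have : Z.X a * Z.X c * (Z.X c ^ 2 * Z.X j) = Z.X a * Z.X c * Z.X j := by
        linear_combination Z.X a * Z.X j * Z.X_cube c
      rw [this]; exact Z.X_mul_X_mul_X_mem _ _ _
    have : Z.X a * Z.X c * (Z.X i ^ 2 * Z.X j) = 0 := by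
      linear_combination Z.X i * Z.X j * Z.X_mul a c i hac hci hai
    rw [this]; exact zero_mem _

theorem X_mul_mul_D_mem (a : Fin d) {p : L} (hp : p ∈ Z.oddPart) :
    Z.X a * p * Z.D ∈ Z.oddPart := by
  rw [Z.D_eq, Finset.mul_sum]
  refine sum_mem fun i _ => ?_
  rw [mul_smul_comm]
  refine Submodule.smul_mem _ _ ?_
  have : Z.X a * p * Z.X i = Z.X a * Z.X i * p := by ring
  rw [this]; exact Z.X_mul_X_mul_mem _ _ hp

theorem mul_D_sq_mem {p : L} (hp : p ∈ Z.oddPart) : p * Z.D ^ 2 ∈ Z.oddPart := by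
  have : p * Z.D ^ 2 = ∑ i, Z.del i • (Z.X i * p * Z.D) := by
    simp only [← smul_mul_assoc, ← Finset.sum_mul, ← Z.D_eq]; ring
  rw [this]
  exact sum_mem fun i _ => Submodule.smul_mem _ _ (Z.X_mul_mul_D_mem i hp)

theorem D_mem : Z.D ∈ Z.oddPart := by
  rw [Z.D_eq]; exact sum_mem fun i _ => Submodule.smul_mem _ _ (Z.X_mem i)

/-! Orders `h ^ 5` and `h ^ 4`. -/

/-- Every term of `B` is divisible by `h`, so one further factor of `h` reaches `h ^ 6`. The long
linear combination cancels these terms one by one. -/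
theorem h5_E_mul_B (m : L) : Z.h ^ 5 • Z.E (m * Z.B) = 0 := by
  rw [E_mul_B]
  have h6 := fun q => Z.h6 q
  have : ∀ q : Q, ∀ r : R, (r * Z.h ^ 6) • q = 0 := fun q r => by rw [mul_smul, h6, smul_zero]
  linear_combination (norm := skip) this (Z.E (m * Z.D)) 1 + this (Z.E m) (Z.h * Z.τ)
    + this (Z.E (m * Z.D ^ 2)) ((1 / 2 : ℝ) • Z.h) + this (Z.E (m * Z.D)) (Z.h ^ 2 * Z.τ)
    + this (Z.E (m * Z.D ^ 3)) ((1 / 6 : ℝ) • Z.h ^ 2)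
    + this (Z.E m) ((1 / 2 : ℝ) • (Z.h ^ 3 * Z.τ ^ 2))
    + this (Z.E (m * Z.D ^ 2)) ((1 / 2 : ℝ) • (Z.h ^ 3 * Z.τ))
    + this (Z.E (m * Z.D ^ 4)) ((1 / 24 : ℝ) • Z.h ^ 3)
    + this (Z.E (m * Z.D)) ((1 / 2 : ℝ) • (Z.h ^ 4 * Z.τ ^ 2))
    + this (Z.E (m * Z.D ^ 3)) ((1 / 6 : ℝ) • (Z.h ^ 4 * Z.τ))
    + this (Z.E (m * Z.D ^ 5)) ((1 / 120 : ℝ) • Z.h ^ 4) + this (Z.E (m * Z.C)) (Z.h ^ 5)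
  match_scalars <;> algebra

/-- The starting point of the bootstrap: `rel_odd` has no equilibrium and no source term, so an odd
moment is a multiple of a moment with a factor `B`. -/
theorem h5_E_odd {p : L} (hp : p ∈ Z.oddPart) : Z.h ^ 5 • Z.E p = 0 := by
  induction hp using Submodule.span_induction with
  | zero => simp
  | add x y _ _ hx hy => rw [map_add, smul_add, hx, hy, add_zero]
  | smul r x _ hx => rw [map_smul, smul_comm, hx, smul_zero]
  | mem x hx =>
    obtain ⟨⟨i, j⟩, rfl⟩ := hx
    show Z.h ^ 5 • Z.E (Z.X i ^ 2 * Z.X j) = 0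
    rw [Z.rel_odd, smul_neg, smul_comm, h5_E_mul_B, smul_zero, neg_zero]

/-- A truncation of `E_mul_B` by one more order. -/
theorem h4_E_mul_B (m : L) : Z.h ^ 4 • Z.E (m * Z.B) = Z.h ^ 5 • Z.E (m * Z.D) := by
  rw [E_mul_B]
  have this : ∀ q : Q, ∀ r : R, (r * Z.h ^ 6) • q = 0 := fun q r => by
    rw [mul_smul, Z.h6, smul_zero]
  linear_combination (norm := skip) this (Z.E m) (Z.τ)
    + this (Z.E (m * Z.D ^ 2)) ((1 / 2 : ℝ) • 1) + this (Z.E (m * Z.D)) (Z.h * Z.τ)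
    + this (Z.E (m * Z.D ^ 3)) ((1 / 6 : ℝ) • Z.h)
    + this (Z.E m) ((1 / 2 : ℝ) • (Z.h ^ 2 * Z.τ ^ 2))
    + this (Z.E (m * Z.D ^ 2)) ((1 / 2 : ℝ) • (Z.h ^ 2 * Z.τ))
    + this (Z.E (m * Z.D ^ 4)) ((1 / 24 : ℝ) • Z.h ^ 2)
    + this (Z.E (m * Z.D)) ((1 / 2 : ℝ) • (Z.h ^ 3 * Z.τ ^ 2))
    + this (Z.E (m * Z.D ^ 3)) ((1 / 6 : ℝ) • (Z.h ^ 3 * Z.τ))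
    + this (Z.E (m * Z.D ^ 5)) ((1 / 120 : ℝ) • Z.h ^ 3) + this (Z.E (m * Z.C)) (Z.h ^ 4)
  match_scalars <;> algebra

theorem h3_E_mul_B (m : L) : Z.h ^ 3 • Z.E (m * Z.B) = Z.h ^ 4 • Z.E (m * Z.D)
    + (Z.h ^ 5 * Z.τ) • Z.E m + ((1 / 2 : ℝ) • Z.h ^ 5) • Z.E (m * Z.D ^ 2) := by
  rw [E_mul_B]
  have this : ∀ q : Q, ∀ r : R, (r * Z.h ^ 6) • q = 0 := fun q r => by
    rw [mul_smul, Z.h6, smul_zero]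
  linear_combination (norm := skip) this (Z.E (m * Z.D)) (Z.τ)
    + this (Z.E (m * Z.D ^ 3)) ((1 / 6 : ℝ) • 1)
    + this (Z.E m) ((1 / 2 : ℝ) • (Z.h * Z.τ ^ 2))
    + this (Z.E (m * Z.D ^ 2)) ((1 / 2 : ℝ) • (Z.h * Z.τ))
    + this (Z.E (m * Z.D ^ 4)) ((1 / 24 : ℝ) • Z.h)
    + this (Z.E (m * Z.D)) ((1 / 2 : ℝ) • (Z.h ^ 2 * Z.τ ^ 2))
    + this (Z.E (m * Z.D ^ 3)) ((1 / 6 : ℝ) • (Z.h ^ 2 * Z.τ))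
    + this (Z.E (m * Z.D ^ 5)) ((1 / 120 : ℝ) • Z.h ^ 2) + this (Z.E (m * Z.C)) (Z.h ^ 3)
  match_scalars <;> algebra

theorem h2_E_mul_B (m : L) : Z.h ^ 2 • Z.E (m * Z.B) = Z.h ^ 3 • Z.E (m * Z.D)
    + (Z.h ^ 4 * Z.τ) • Z.E m + ((1 / 2 : ℝ) • Z.h ^ 4) • Z.E (m * Z.D ^ 2)
    + (Z.h ^ 5 * Z.τ) • Z.E (m * Z.D) + ((1 / 6 : ℝ) • Z.h ^ 5) • Z.E (m * Z.D ^ 3) := by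
  rw [E_mul_B]
  have this : ∀ q : Q, ∀ r : R, (r * Z.h ^ 6) • q = 0 := fun q r => by
    rw [mul_smul, Z.h6, smul_zero]
  linear_combination (norm := skip) this (Z.E m) ((1 / 2 : ℝ) • (Z.τ ^ 2))
    + this (Z.E (m * Z.D ^ 2)) ((1 / 2 : ℝ) • (Z.τ))
    + this (Z.E (m * Z.D ^ 4)) ((1 / 24 : ℝ) • 1)
    + this (Z.E (m * Z.D)) ((1 / 2 : ℝ) • (Z.h * Z.τ ^ 2))
    + this (Z.E (m * Z.D ^ 3)) ((1 / 6 : ℝ) • (Z.h * Z.τ))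
    + this (Z.E (m * Z.D ^ 5)) ((1 / 120 : ℝ) • Z.h) + this (Z.E (m * Z.C)) (Z.h ^ 2)
  match_scalars <;> algebra

theorem h1_E_mul_B (m : L) : Z.h • Z.E (m * Z.B) = Z.h ^ 2 • Z.E (m * Z.D)
    + (Z.h ^ 3 * Z.τ) • Z.E m + ((1 / 2 : ℝ) • Z.h ^ 3) • Z.E (m * Z.D ^ 2)
    + (Z.h ^ 4 * Z.τ) • Z.E (m * Z.D) + ((1 / 6 : ℝ) • Z.h ^ 4) • Z.E (m * Z.D ^ 3)
    + ((1 / 2 : ℝ) • (Z.h ^ 5 * Z.τ ^ 2)) • Z.E m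
    + ((1 / 2 : ℝ) • (Z.h ^ 5 * Z.τ)) • Z.E (m * Z.D ^ 2)
    + ((1 / 24 : ℝ) • Z.h ^ 5) • Z.E (m * Z.D ^ 4) := by
  rw [E_mul_B]
  have this : ∀ q : Q, ∀ r : R, (r * Z.h ^ 6) • q = 0 := fun q r => by
    rw [mul_smul, Z.h6, smul_zero]
  linear_combination (norm := skip) this (Z.E (m * Z.D)) ((1 / 2 : ℝ) • (Z.τ ^ 2))
    + this (Z.E (m * Z.D ^ 3)) ((1 / 6 : ℝ) • (Z.τ))
    + this (Z.E (m * Z.D ^ 5)) ((1 / 120 : ℝ) • 1) + this (Z.E (m * Z.C)) (Z.h)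
  match_scalars <;> algebra

/-- Even moments agree with their equilibrium up to two orders: the source carries `h ^ 2`, and the
first-order part of `E (m * B)` is the moment of `m * D`, which is odd. -/
theorem h4_E_eq (m : L) (r : R) (w c : ℝ) (hm : m * Z.D ∈ Z.oddPart)
    (hr : Z.E m = (w • (1 : R)) • Z.φ + (c • Z.h ^ 2) • Z.F - r • Z.E (m * Z.B)) :
    Z.h ^ 4 • Z.E m = (w • Z.h ^ 4) • Z.φ := by
  have h1 := Z.h4_E_mul_B m
  rw [Z.h5_E_odd hm] at h1
  have h2 := Z.h6 Z.F
  linear_combination (norm := skip) Z.h ^ 4 • hr - r • h1 + (c • (1 : R)) • h2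
  match_scalars <;> algebra

theorem h4_E_sq (i : Fin d) : Z.h ^ 4 • Z.E (Z.X i ^ 2) = (Z.W i i • Z.h ^ 4) • Z.φ := by
  refine Z.h4_E_eq _ _ _ _ ?_ (Z.rel_sq i)
  rw [sq]; exact Z.X_mul_mul_D_mem i (Z.X_mem i)

theorem h4_E_mixed (i j : Fin d) (hij : i ≠ j) : Z.h ^ 4 • Z.E (Z.X i * Z.X j) = 0 := by
  have := Z.h4_E_eq (Z.X i * Z.X j) (Z.b i j • (1 : R)) 0 0 (Z.X_mul_mul_D_mem i (Z.X_mem j))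
    (by rw [Z.rel_mixed i j hij]; simp)
  simpa using this

theorem h4_E_four (i j : Fin d) :
    Z.h ^ 4 • Z.E (Z.X i ^ 2 * Z.X j ^ 2) = (Z.W i j • Z.h ^ 4) • Z.φ := by
  by_cases hij : i = j
  · subst hij
    rw [← pow_add, Z.X_pow_four]; exact Z.h4_E_sq i
  refine Z.h4_E_eq _ _ _ _ ?_ (Z.rel_four i j hij)
  have : Z.X i ^ 2 * Z.X j ^ 2 * Z.D = Z.X i * (Z.X i * Z.X j ^ 2) * Z.D := by ring
  rw [this]; exact Z.X_mul_mul_D_mem i (Z.X_mul_X_sq_mem _ _)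

/-- Only the summand of `D` along `X j` restores an even power in every coordinate. The others
reduce to mixed second moments, whose equilibrium is zero, or to a vanishing triple product. -/
theorem h4_E_odd_mul_D (i j : Fin d) : Z.h ^ 4 • Z.E (Z.X i ^ 2 * Z.X j * Z.D)
    = (Z.W i j • (Z.h ^ 4 * Z.del j)) • Z.φ := by
  rw [Z.D_eq, Finset.mul_sum, map_sum, Finset.smul_sum, Finset.sum_eq_single j]
  · rw [mul_smul_comm, map_smul, smul_comm, mul_assoc, ← sq, h4_E_four]
    match_scalars; algebra
  · intro l _ hlj
    rw [mul_smul_comm, map_smul, smul_comm]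
    suffices Z.h ^ 4 • Z.E (Z.X i ^ 2 * Z.X j * Z.X l) = 0 by rw [this, smul_zero]
    by_cases hij : i = j
    · subst hij
      rw [← pow_succ, Z.X_cube, h4_E_mixed _ _ _ (Ne.symm hlj)]
    by_cases hil : i = l
    · subst hil
      have : Z.X i ^ 2 * Z.X j * Z.X i = Z.X i * Z.X j := by linear_combination Z.X j * Z.X_cube i
      rw [this, h4_E_mixed _ _ _ hij]
    have : Z.X i ^ 2 * Z.X j * Z.X l = 0 := by
      linear_combination Z.X i * Z.X_mul i j l hij (Ne.symm hlj) hil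
    rw [this, map_zero, smul_zero]
  · simp

/-! Order `h ^ 3`. -/

theorem h4_g (i j : Fin d) (q : Q) : (Z.h ^ 4 * Z.g i j) • q = (Z.gt i j • Z.h ^ 4) • q := by
  rw [Z.g_eq]
  linear_combination (norm := skip) Z.gr i j • Z.h6 q
  match_scalars; algebra

theorem h3_E_odd (i j : Fin d) : Z.h ^ 3 • Z.E (Z.X i ^ 2 * Z.X j)
    = -((Z.gt i j * Z.W i j) • (Z.h ^ 4 * Z.del j)) • Z.φ := by
  have h1 := Z.h3_E_mul_B (Z.X i ^ 2 * Z.X j)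
  have h2 := Z.h5_E_odd (Z.X_sq_mul_mem i j)
  have h3 := Z.h5_E_odd (Z.mul_D_sq_mem (Z.X_sq_mul_mem i j))
  have h4 := Z.h4_E_odd_mul_D i j
  linear_combination (norm := skip) Z.h ^ 3 • Z.rel_odd i j - Z.g i j • h1 - (Z.g i j * Z.τ) • h2
    - ((1 / 2 : ℝ) • Z.g i j) • h3 - Z.g i j • h4 - (Z.W i j • Z.del j) • Z.h4_g i j Z.φ
  match_scalars <;> algebra

theorem h3_E_X (i : Fin d) : Z.h ^ 3 • Z.E (Z.X i)
    = -((Z.gt i i * Z.W i i) • (Z.h ^ 4 * Z.del i)) • Z.φ := by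
  rw [← h3_E_odd, ← pow_succ, Z.X_cube]

/-! Second-order operators occurring in the expansion. -/

/-- The five operators collect leading parts of moments along direction `i`: `opG` comes from `X_i ^
2 * D`, `opW` from `X_i ^ 2 * D ^ 2`, `opK` from the mixed moments inside `X_i * D`, `opH` from `X_i
* D ^ 2` and `opM` from `X_i * D ^ 3`. -/
def opG (i : Fin d) : R := ∑ j, (Z.gt i j * Z.W i j) • Z.del j ^ 2

def opW (i : Fin d) : R := ∑ j, Z.W i j • Z.del j ^ 2

def opK (i : Fin d) : R :=
  ∑ j, (offDiag i j * Z.b i j * (Z.gt i j + Z.gt j i - 1) * Z.W i j) • Z.del j ^ 2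

def opH (i : Fin d) : R :=
  ∑ j, ((1 / 2 * Z.gt j i + offDiag i j * Z.gt i j) * Z.W i j) • Z.del j ^ 2

def opM (i : Fin d) : R := ∑ j, ((1 + 2 * offDiag i j) * Z.W i j) • Z.del j ^ 2

/-! Products of coordinates with `D`. -/

theorem mul_D (m : L) : m * Z.D = ∑ j, Z.del j • (m * Z.X j) := by
  rw [Z.D_eq, Finset.mul_sum]; simp only [mul_smul_comm]

theorem mul_D_sq (m : L) : m * Z.D ^ 2 = ∑ j, Z.del j • (m * Z.X j * Z.D) := by
  rw [sq, ← mul_assoc, mul_D Z m, Finset.sum_mul]; simp only [smul_mul_assoc]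

theorem X_mul_X_mul_D (i j : Fin d) (hij : i ≠ j) : Z.X i * Z.X j * Z.D
    = Z.del i • (Z.X i ^ 2 * Z.X j) + Z.del j • (Z.X j ^ 2 * Z.X i) := by
  rw [mul_D, Finset.sum_eq_add i j hij]
  · congr 2 <;> ring
  · rintro l - ⟨h1, h2⟩
    rw [Z.X_mul i j l hij (Ne.symm h2) (Ne.symm h1), smul_zero]
  · simp
  · simp

/-- Terms with three distinct indices vanish. The monomial `X_i ^ 2 * X_j` with `j ≠ i` arises from
both orders of the two factors `D`, whence the `2`. -/
theorem X_mul_D_sq (i : Fin d) : Z.X i * Z.D ^ 2 = ∑ j, (Z.del j ^ 2 • (Z.X j ^ 2 * Z.X i)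
    + ((2 * offDiag i j) • (Z.del i * Z.del j)) • (Z.X i ^ 2 * Z.X j)) := by
  have h1 : ∀ j, Z.del j • (Z.X i * Z.X j * Z.D)
      = ((1 - offDiag i j) • Z.del j) • (Z.X i ^ 2 * Z.D)
        + ((offDiag i j) • (Z.del i * Z.del j)) • (Z.X i ^ 2 * Z.X j)
        + ((offDiag i j) • (Z.del j ^ 2)) • (Z.X j ^ 2 * Z.X i) := by
    intro j
    by_cases hij : i = j
    · subst hij
      simp [offDiag, sq]
    · rw [X_mul_X_mul_D _ _ _ hij]
      simp only [offDiag, hij, if_false, one_smul, sub_self, zero_smul, zero_add]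
      module
  have h2 : ∑ j, ((1 - offDiag i j) • Z.del j) • (Z.X i ^ 2 * Z.D) = Z.del i • (Z.X i ^ 2 * Z.D) := by
    rw [Finset.sum_eq_single i]
    · simp [offDiag]
    · intro j _ hji
      simp [offDiag, Ne.symm hji]
    · simp
  rw [mul_D_sq]
  simp only [h1, Finset.sum_add_distrib, h2]
  rw [mul_D, Finset.smul_sum]
  simp only [← Finset.sum_add_distrib]
  refine Finset.sum_congr rfl fun j _ => ?_
  by_cases hij : i = j
  · subst hij
    simp [offDiag, smul_smul, sq]
  · simp only [offDiag, hij, if_false]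
    match_scalars <;> algebra

/-! Order `h ^ 2`. -/

theorem h3_E_sq_mul_D (i : Fin d) :
    Z.h ^ 3 • Z.E (Z.X i ^ 2 * Z.D) = -(Z.h ^ 4 * Z.opG i) • Z.φ := by
  rw [mul_D, map_sum, Finset.smul_sum, opG, Finset.mul_sum, ← Finset.sum_neg_distrib,
    Finset.sum_smul]
  refine Finset.sum_congr rfl fun j _ => ?_
  rw [map_smul, smul_comm, h3_E_odd]
  match_scalars; algebra

theorem h4_E_sq_mul_D_sq (i : Fin d) :
    Z.h ^ 4 • Z.E (Z.X i ^ 2 * Z.D ^ 2) = (Z.h ^ 4 * Z.opW i) • Z.φ := by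
  rw [mul_D_sq, map_sum, Finset.smul_sum, opW, Finset.mul_sum, Finset.sum_smul]
  refine Finset.sum_congr rfl fun j _ => ?_
  rw [map_smul, smul_comm, h4_E_odd_mul_D]
  match_scalars; algebra

/-- The source is now visible, since its own `h ^ 2` only raises the order to `h ^ 4`. The
correction is `-b` times the expansion of `E (X_i ^ 2 * B)`, in which the terms of order `h ^ 5` are
odd and drop out. -/
theorem h2_E_sq (i : Fin d) : Z.h ^ 2 • Z.E (Z.X i ^ 2) = (Z.W i i • Z.h ^ 2) • Z.φ
    + ((Z.W i i * Z.ξ * (Z.b i i - 1 / 2)) • Z.h ^ 4) • Z.F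
    + (Z.b i i • (Z.h ^ 4 * (Z.opG i - Z.W i i • Z.τ - (1 / 2 : ℝ) • Z.opW i))) • Z.φ := by
  have m1 : Z.X i ^ 2 * Z.D ∈ Z.oddPart := by rw [sq]; exact Z.X_mul_mul_D_mem i (Z.X_mem i)
  have m3 : Z.X i ^ 2 * Z.D ^ 3 ∈ Z.oddPart := by
    have := Z.mul_D_sq_mem m1
    rwa [mul_assoc, ← pow_succ'] at this
  linear_combination (norm := skip) Z.h ^ 2 • Z.rel_sq i
    - (Z.b i i • (1 : R)) • Z.h2_E_mul_B (Z.X i ^ 2)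
    - (Z.b i i • (1 : R)) • Z.h3_E_sq_mul_D i - (Z.b i i • Z.τ) • Z.h4_E_sq i
    - ((1 / 2 * Z.b i i) • (1 : R)) • Z.h4_E_sq_mul_D_sq i
    - (Z.b i i • Z.τ) • Z.h5_E_odd m1 - ((1 / 6 * Z.b i i) • (1 : R)) • Z.h5_E_odd m3
  match_scalars <;> algebra

/-- There is no equilibrium, so the result is entirely a correction: `gt i j + gt j i` comes from
the two odd moments in `X_i * X_j * D`, and `-1` from half the second-order Taylor term. -/
theorem h2_E_mixed (i j : Fin d) (hij : i ≠ j) : Z.h ^ 2 • Z.E (Z.X i * Z.X j)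
    = ((Z.b i j * (Z.gt i j + Z.gt j i - 1) * Z.W i j) • (Z.h ^ 4 * Z.del i * Z.del j)) • Z.φ := by
  have m1 : Z.X i * Z.X j * Z.D ∈ Z.oddPart := Z.X_mul_mul_D_mem i (Z.X_mem j)
  have m3 : Z.X i * Z.X j * Z.D ^ 3 ∈ Z.oddPart := by
    have := Z.mul_D_sq_mem m1
    rwa [mul_assoc, ← pow_succ'] at this
  have e1 : Z.h ^ 3 • Z.E (Z.X i * Z.X j * Z.D)
      = -(((Z.gt i j + Z.gt j i) * Z.W i j) • (Z.h ^ 4 * Z.del i * Z.del j)) • Z.φ := by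
    rw [X_mul_X_mul_D _ _ _ hij, map_add, map_smul, map_smul]
    have h1 := Z.h3_E_odd i j
    have h2 := Z.h3_E_odd j i
    rw [Z.W_symm j i] at h2
    linear_combination (norm := skip) Z.del i • h1 + Z.del j • h2
    match_scalars <;> algebra
  have e2 : Z.h ^ 4 • Z.E (Z.X i * Z.X j * Z.D ^ 2)
      = ((2 * Z.W i j) • (Z.h ^ 4 * Z.del i * Z.del j)) • Z.φ := by
    rw [sq, ← mul_assoc, X_mul_X_mul_D _ _ _ hij, add_mul, smul_mul_assoc, smul_mul_assoc,
      map_add, map_smul, map_smul]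
    have h1 := Z.h4_E_odd_mul_D i j
    have h2 := Z.h4_E_odd_mul_D j i
    rw [Z.W_symm j i] at h2
    linear_combination (norm := skip) Z.del i • h1 + Z.del j • h2
    match_scalars <;> algebra
  linear_combination (norm := skip) Z.h ^ 2 • Z.rel_mixed i j hij
    - (Z.b i j • (1 : R)) • Z.h2_E_mul_B (Z.X i * Z.X j)
    - (Z.b i j • (1 : R)) • e1 - (Z.b i j • Z.τ) • Z.h4_E_mixed i j hij
    - ((1 / 2 * Z.b i j) • (1 : R)) • e2
    - (Z.b i j • Z.τ) • Z.h5_E_odd m1 - ((1 / 6 * Z.b i j) • (1 : R)) • Z.h5_E_odd m3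
  match_scalars <;> algebra

theorem h2_E_X_mul_D (i : Fin d) : Z.h ^ 2 • Z.E (Z.X i * Z.D)
    = (Z.W i i • (Z.h ^ 2 * Z.del i)) • Z.φ
    + ((Z.W i i * Z.ξ * (Z.b i i - 1 / 2)) • (Z.h ^ 4 * Z.del i)) • Z.F
    + (Z.h ^ 4 * Z.del i * (Z.b i i • (Z.opG i - Z.W i i • Z.τ - (1 / 2 : ℝ) • Z.opW i)
        + Z.opK i)) • Z.φ := by
  -- The summand `j = i` is the square moment, and the others are the mixed moments collected in
  -- `opK`. The factor `1 - offDiag i j` selects the former so that one formula covers both cases.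
  have h1 : ∀ j, Z.h ^ 2 • Z.del j • Z.E (Z.X i * Z.X j)
      = ((1 - offDiag i j) • Z.del j) • (Z.h ^ 2 • Z.E (Z.X i ^ 2))
        + ((Z.h ^ 4 * Z.del i) * ((offDiag i j * Z.b i j * (Z.gt i j + Z.gt j i - 1) * Z.W i j)
          • Z.del j ^ 2)) • Z.φ := by
    intro j
    by_cases hij : i = j
    · subst hij
      simp only [offDiag, if_true, ← sq]
      match_scalars <;> algebra
    · rw [smul_comm, h2_E_mixed _ _ _ hij]
      simp only [offDiag, hij, if_false]
      match_scalars <;> algebra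
  have h2 : ∀ q : Q, ∑ j, ((1 - offDiag i j) • Z.del j) • q = Z.del i • q := by
    intro q
    rw [Finset.sum_eq_single i]
    · simp [offDiag]
    · intro j _ hji
      simp [offDiag, Ne.symm hji]
    · simp
  rw [mul_D, map_sum, Finset.smul_sum]
  simp only [map_smul]
  rw [Finset.sum_congr rfl fun j _ => h1 j, Finset.sum_add_distrib, h2, ← Finset.sum_smul,
    ← Finset.mul_sum, ← opK, h2_E_sq]
  match_scalars <;> algebra

/-! Order `h`. -/

theorem h3_E_X_mul_D_sq (i : Fin d) : Z.h ^ 3 • Z.E (Z.X i * Z.D ^ 2)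
    = -((2 : ℝ) • (Z.h ^ 4 * Z.del i * Z.opH i)) • Z.φ := by
  rw [X_mul_D_sq, map_sum, Finset.smul_sum, opH, Finset.mul_sum, Finset.smul_sum,
    ← Finset.sum_neg_distrib, Finset.sum_smul]
  refine Finset.sum_congr rfl fun j _ => ?_
  have h1 := Z.h3_E_odd j i
  have h2 := Z.h3_E_odd i j
  rw [Z.W_symm j i] at h1
  rw [map_add, map_smul, map_smul]
  linear_combination (norm := skip) Z.del j ^ 2 • h1
    + ((2 * offDiag i j) • (Z.del i * Z.del j)) • h2
  match_scalars <;> algebra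

theorem h4_E_X_mul_D (i : Fin d) :
    Z.h ^ 4 • Z.E (Z.X i * Z.D) = (Z.W i i • (Z.h ^ 4 * Z.del i)) • Z.φ := by
  rw [← h4_E_odd_mul_D, ← pow_succ, Z.X_cube]

theorem h4_E_X_mul_D_cube (i : Fin d) :
    Z.h ^ 4 • Z.E (Z.X i * Z.D ^ 3) = (Z.h ^ 4 * Z.del i * Z.opM i) • Z.φ := by
  rw [pow_succ Z.D, ← mul_assoc, X_mul_D_sq, Finset.sum_mul, map_sum, Finset.smul_sum, opM,
    Finset.mul_sum, Finset.sum_smul]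
  refine Finset.sum_congr rfl fun j _ => ?_
  have h1 := Z.h4_E_odd_mul_D j i
  have h2 := Z.h4_E_odd_mul_D i j
  rw [Z.W_symm j i] at h1
  rw [add_mul, smul_mul_assoc, smul_mul_assoc, map_add, map_smul, map_smul]
  linear_combination (norm := skip) Z.del j ^ 2 • h1
    + ((2 * offDiag i j) • (Z.del i * Z.del j)) • h2
  match_scalars <;> algebra

/-- The exact `g i i` is kept in the leading term, because its difference from `gt i i` has order `h
^ 2` and contributes at order `h ^ 4`. In the terms already of order `h ^ 4` it may be replaced by
its limit. -/
theorem h1_E_X (i : Fin d) : Z.h • Z.E (Z.X i) = -(Z.W i i • (Z.g i i * Z.h ^ 2 * Z.del i)) • Z.φ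
    - ((Z.gt i i * Z.W i i * Z.ξ * (Z.b i i - 1 / 2)) • (Z.h ^ 4 * Z.del i)) • Z.F
    - (Z.gt i i • (Z.h ^ 4 * Z.del i
        * (Z.b i i • (Z.opG i - Z.W i i • Z.τ - (1 / 2 : ℝ) • Z.opW i) + Z.opK i
          - (Z.gt i i * Z.W i i) • Z.τ - Z.opH i + Z.W i i • Z.τ
          + (1 / 6 : ℝ) • Z.opM i))) • Z.φ := by
  have hr := Z.rel_odd i i
  rw [← pow_succ, Z.X_cube] at hr
  have m1 := Z.X_mem i
  have m2 := Z.mul_D_sq_mem m1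
  have m4 := Z.mul_D_sq_mem m2
  rw [mul_assoc, ← pow_add] at m4
  have hg := Z.h4_g i i
  linear_combination (norm := skip) Z.h • hr - Z.g i i • Z.h1_E_mul_B (Z.X i)
    - Z.g i i • Z.h2_E_X_mul_D i - (Z.g i i * Z.τ) • Z.h3_E_X i
    - ((1 / 2 : ℝ) • Z.g i i) • Z.h3_E_X_mul_D_sq i - (Z.g i i * Z.τ) • Z.h4_E_X_mul_D i
    - ((1 / 6 : ℝ) • Z.g i i) • Z.h4_E_X_mul_D_cube i
    - ((1 / 2 : ℝ) • (Z.g i i * Z.τ ^ 2)) • Z.h5_E_odd m1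
    - ((1 / 2 : ℝ) • (Z.g i i * Z.τ)) • Z.h5_E_odd m2
    - ((1 / 24 : ℝ) • Z.g i i) • Z.h5_E_odd m4
    - ((Z.W i i * Z.ξ * (Z.b i i - 1 / 2)) • Z.del i) • hg Z.F
    - (Z.del i * (Z.b i i • (Z.opG i - Z.W i i • Z.τ - (1 / 2 : ℝ) • Z.opW i) + Z.opK i
          - (Z.gt i i * Z.W i i) • Z.τ - Z.opH i + Z.W i i • Z.τ
          + (1 / 6 : ℝ) • Z.opM i)) • hg Z.φ
  match_scalars <;> algebra

/-! The conservation law. -/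

theorem E_D_pow_succ (n : ℕ) : Z.E (Z.D ^ (n + 1)) = ∑ i, Z.del i • Z.E (Z.X i * Z.D ^ n) := by
  rw [pow_succ', Z.D_eq, Finset.sum_mul, map_sum]
  simp only [smul_mul_assoc, map_smul]

theorem smul_E_D_pow_succ (r : R) (n : ℕ) :
    r • Z.E (Z.D ^ (n + 1)) = ∑ i, Z.del i • (r • Z.E (Z.X i * Z.D ^ n)) := by
  rw [E_D_pow_succ, Finset.smul_sum]
  simp only [smul_comm r]

/-- The operator `∑ (1 / s̃_i - 1 / 2) A_i ∂_i²`. -/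
def opP : R := ∑ i, ((Z.gt i i - 1 / 2) * Z.W i i) • Z.del i ^ 2

/-- The quadratic relation `gr_eq`, which encodes condition (1), turns the unspecified `h ^ 2`
correction of `g i i` into an explicit multiple of `η`. -/
theorem h2_g (i : Fin d) (q : Q) : (Z.h ^ 2 * Z.g i i) • q = (Z.gt i i • Z.h ^ 2) • q
    + ((Z.ξ * Z.η * (Z.gt i i ^ 2 - Z.gt i i)) • Z.h ^ 4) • q := by
  have h1 := Z.h4_g i i q
  have h2 := Z.h4_g i i (Z.g i i • q)
  have h3 : (Z.h ^ 2 * Z.g i i) • q = (Z.h ^ 2 * (Z.gt i i • 1 + Z.h ^ 2 * Z.gr i i)) • q := by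
    rw [← Z.g_eq]
  rw [Z.gr_eq] at h3
  linear_combination (norm := skip) h3 + ((Z.ξ * Z.η) • (1 : R)) • h2
    + ((Z.ξ * Z.η * Z.gt i i) • (1 : R)) • h1 - ((Z.ξ * Z.η) • (1 : R)) • h1
  match_scalars; algebra

/-- The fourth-order contribution in the direction `i`. -/
def opT (i : Fin d) : R := (Z.gt i i - 1 / 2) •
      (Z.b i i • (Z.opG i - Z.W i i • Z.τ - (1 / 2 : ℝ) • Z.opW i) + Z.opK i)
    + Z.gt i i • (-((Z.gt i i * Z.W i i) • Z.τ) - Z.opH i + Z.W i i • Z.τ + (1 / 6 : ℝ) • Z.opM i)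
    + (Z.gt i i * Z.W i i) • Z.τ + (1 / 3 : ℝ) • Z.opH i - (1 / 2 * Z.W i i) • Z.τ
    - (1 / 24 : ℝ) • Z.opM i + (Z.ξ * Z.η * (Z.gt i i ^ 2 - Z.gt i i) * Z.W i i) • 1

theorem conservation_expansion : (Z.h ^ 2 * Z.τ) • Z.φ = (Z.h ^ 2 * Z.opP) • Z.φ
    + (Z.ξ • Z.h ^ 2) • Z.F + ((1 / 2 * Z.ξ) • (Z.h ^ 4 * Z.τ)) • Z.F
    - ((1 / 2 : ℝ) • (Z.h ^ 4 * Z.τ ^ 2)) • Z.φ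
    + ∑ i, (((Z.ξ * (Z.gt i i - 1 / 2) * (Z.b i i - 1 / 2) * Z.W i i)
        • (Z.h ^ 4 * Z.del i ^ 2)) • Z.F + (Z.h ^ 4 * Z.del i ^ 2 * Z.opT i) • Z.φ) := by
  have m1 := Z.D_mem
  have m3 := Z.mul_D_sq_mem m1
  have m5 := Z.mul_D_sq_mem m3
  rw [← pow_succ'] at m3
  rw [mul_assoc, ← pow_add, ← pow_succ'] at m5
  have eB := Z.E_mul_B 1
  simp only [one_mul] at eB
  have kill : ∀ q : Q, ∀ r : R, (r * Z.h ^ 6) • q = 0 := fun q r => by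
    rw [mul_smul, Z.h6, smul_zero]
  have e1 := Z.smul_E_D_pow_succ Z.h 0
  simp only [pow_zero, mul_one, zero_add, pow_one, h1_E_X] at e1
  have e2 := Z.smul_E_D_pow_succ (Z.h ^ 2) 1
  simp only [pow_one, one_add_one_eq_two, h2_E_X_mul_D] at e2
  have e3 := Z.smul_E_D_pow_succ (Z.h ^ 3) 0
  simp only [pow_zero, mul_one, zero_add, pow_one, h3_E_X] at e3
  have e4 := Z.smul_E_D_pow_succ (Z.h ^ 3) 2
  simp only [Nat.reduceAdd, h3_E_X_mul_D_sq] at e4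
  have e5 := Z.smul_E_D_pow_succ (Z.h ^ 4) 1
  simp only [pow_one, one_add_one_eq_two, h4_E_X_mul_D] at e5
  have e6 := Z.smul_E_D_pow_succ (Z.h ^ 4) 3
  simp only [Nat.reduceAdd, h4_E_X_mul_D_cube] at e6
  -- The right-hand side consists of the terms of `E B` that contain `D` and survive at this order.
  -- The remaining terms involve only `E 1`, which `mass` replaces by `φ` and `F`.
  have key : (Z.h ^ 2 * Z.opP) • Z.φ + ∑ i, (((Z.ξ * (Z.gt i i - 1 / 2) * (Z.b i i - 1 / 2)
      * Z.W i i) • (Z.h ^ 4 * Z.del i ^ 2)) • Z.F + (Z.h ^ 4 * Z.del i ^ 2 * Z.opT i) • Z.φ)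
      = -(Z.h • Z.E Z.D + ((1 / 2 : ℝ) • (1 : R)) • (Z.h ^ 2 • Z.E (Z.D ^ 2))
        + Z.τ • (Z.h ^ 3 • Z.E Z.D) + ((1 / 6 : ℝ) • (1 : R)) • (Z.h ^ 3 • Z.E (Z.D ^ 3))
        + ((1 / 2 : ℝ) • Z.τ) • (Z.h ^ 4 • Z.E (Z.D ^ 2))
        + ((1 / 24 : ℝ) • (1 : R)) • (Z.h ^ 4 • Z.E (Z.D ^ 4))) := by
    rw [e1, e2, e3, e4, e5, e6, opP]
    simp only [Finset.smul_sum, Finset.mul_sum, Finset.sum_smul, ← Finset.sum_add_distrib,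
      ← Finset.sum_neg_distrib]
    refine Finset.sum_congr rfl fun i _ => ?_
    rw [opT]
    linear_combination (norm := skip) (-(Z.W i i • Z.del i ^ 2)) • Z.h2_g i Z.φ
    match_scalars <;> algebra
  linear_combination (norm := skip) Z.cons - eB - key
    - (Z.h ^ 2 * Z.τ + (1 / 2 : ℝ) • (Z.h ^ 4 * Z.τ ^ 2)) • Z.mass
    - ((1 / 2 : ℝ) • Z.τ ^ 2) • Z.h5_E_odd m1
    - ((1 / 6 : ℝ) • Z.τ) • Z.h5_E_odd m3 - ((1 / 120 : ℝ) • (1 : R)) • Z.h5_E_odd m5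
    - Z.h6 (Z.E Z.C) + kill Z.F ((Z.ξ / 4) • Z.τ ^ 2)
  match_scalars <;> algebra

/-- The leading-order equation, obtained by multiplying the expansion by `h ^ 2`. It suffices to
eliminate `τ` from terms that already have order `h ^ 4`. -/
theorem h4_τ : (Z.h ^ 4 * Z.τ) • Z.φ = (Z.h ^ 4 * Z.opP) • Z.φ + (Z.ξ • Z.h ^ 4) • Z.F := by
  have kill : ∀ q : Q, ∀ r : R, (r * Z.h ^ 6) • q = 0 := fun q r => by
    rw [mul_smul, Z.h6, smul_zero]
  have h1 : Z.h ^ 2 • ∑ i, (((Z.ξ * (Z.gt i i - 1 / 2) * (Z.b i i - 1 / 2) * Z.W i i)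
        • (Z.h ^ 4 * Z.del i ^ 2)) • Z.F + (Z.h ^ 4 * Z.del i ^ 2 * Z.opT i) • Z.φ) = 0 := by
    rw [Finset.smul_sum]
    refine Finset.sum_eq_zero fun i _ => ?_
    linear_combination (norm := skip)
      kill Z.F ((Z.ξ * (Z.gt i i - 1 / 2) * (Z.b i i - 1 / 2) * Z.W i i) • Z.del i ^ 2)
      + kill Z.φ (Z.del i ^ 2 * Z.opT i)
    match_scalars <;> algebra
  linear_combination (norm := skip) Z.h ^ 2 • Z.conservation_expansion + h1
    + kill Z.F ((1 / 2 * Z.ξ) • Z.τ) - kill Z.φ ((1 / 2 : ℝ) • Z.τ ^ 2)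
  match_scalars <;> algebra

/-! ### Elimination of the time derivative -/

/-- The part of the fourth-order contribution which involves neither `τ` nor the source. -/
def opN (i : Fin d) : R :=
  (Z.gt i i - 1 / 2) • (Z.b i i • (Z.opG i - (1 / 2 : ℝ) • Z.opW i) + Z.opK i)
    + (1 / 3 - Z.gt i i) • Z.opH i + (1 / 6 * Z.gt i i - 1 / 24) • Z.opM i

/-- The coefficient `e2` in terms of inverse relaxation parameters. -/
def e2inv (a b : ℝ) : ℝ := -(a * b) + b / 2 - a ^ 2 + 2 * a - 1 / 2

theorem opP_F : Z.opP • Z.F = (Z.η • Z.opP) • Z.φ := by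
  rw [opP, Finset.smul_sum, Finset.sum_smul, Finset.sum_smul]
  refine Finset.sum_congr rfl fun i _ => ?_
  linear_combination (norm := skip) (((Z.gt i i - 1 / 2) * Z.W i i) • Z.del i) • Z.del_F i
  match_scalars <;> algebra

theorem modified_equation_op : (Z.h ^ 2 * Z.τ) • Z.φ = (Z.h ^ 2 * Z.opP) • Z.φ
    + (Z.ξ • Z.h ^ 2) • Z.F + (Z.h ^ 4 * (-((1 / 2 : ℝ) • Z.opP ^ 2)
      + ∑ i, Z.del i ^ 2 * ((e2inv (Z.gt i i) (Z.b i i) * Z.W i i) • Z.opP + Z.opN i))) • Z.φ := by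
  have h0 := Z.conservation_expansion
  have hτ := Z.h4_τ
  -- The coefficient of `τ` in `opT` is `e2inv` times `W i i`, which produces the product with
  -- `opP`. Replacing `∂_i F` by `η ∂_i φ`, the source terms and the `η` term from `h2_g` add up to
  -- `ξ η / 2` times `opP`: the dependence on `b` cancels, and so does `gt ^ 2`.
  have key : ∑ i, (((Z.ξ * (Z.gt i i - 1 / 2) * (Z.b i i - 1 / 2) * Z.W i i)
        • (Z.h ^ 4 * Z.del i ^ 2)) • Z.F + (Z.h ^ 4 * Z.del i ^ 2 * Z.opT i) • Z.φ)
      = (Z.h ^ 4 * ((1 / 2 * Z.ξ * Z.η) • Z.opP +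
        ∑ i, Z.del i ^ 2 * ((e2inv (Z.gt i i) (Z.b i i) * Z.W i i) • Z.opP + Z.opN i))) • Z.φ := by
    have hP : (1 / 2 * Z.ξ * Z.η) • Z.opP = ∑ i, (1 / 2 * Z.ξ * Z.η) •
        (((Z.gt i i - 1 / 2) * Z.W i i) • Z.del i ^ 2) := by rw [opP, Finset.smul_sum]
    rw [hP, ← Finset.sum_add_distrib, Finset.mul_sum, Finset.sum_smul]
    refine Finset.sum_congr rfl fun i _ => ?_
    rw [opT, opN, e2inv]
    linear_combination (norm := skip) (((-(Z.gt i i * Z.b i i) + Z.b i i / 2 - Z.gt i i ^ 2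
      + 2 * Z.gt i i - 1 / 2) * Z.W i i) • Z.del i ^ 2) • hτ
      + ((Z.ξ * ((Z.gt i i - 1 / 2) * (Z.b i i - 1 / 2) + (-(Z.gt i i * Z.b i i) + Z.b i i / 2
        - Z.gt i i ^ 2 + 2 * Z.gt i i - 1 / 2)) * Z.W i i) • (Z.h ^ 4 * Z.del i)) • Z.del_F i
    match_scalars <;> algebra
  -- Using the leading-order equation twice turns `-τ ^ 2 φ / 2 + ξ τ F / 2` into `-opP ^ 2 φ / 2 -
  -- ξ η opP φ / 2`. Its last term cancels the `η` contribution of `key`.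
  linear_combination (norm := skip) h0 + key - ((1 / 2 : ℝ) • Z.τ) • hτ
    - ((1 / 2 : ℝ) • Z.opP) • hτ - ((1 / 2 * Z.ξ) • Z.h ^ 4) • Z.opP_F
  match_scalars <;> algebra

/-- The coefficient of `∂_i² ∂_j²` in the second-order truncation error, multiplied by `ξ`. -/
def coef (i j : Fin d) : ℝ :=
  -(1 / 2) * ((Z.gt i i - 1 / 2) * Z.W i i) * ((Z.gt j j - 1 / 2) * Z.W j j)
    + e2inv (Z.gt i i) (Z.b i i) * Z.W i i * ((Z.gt j j - 1 / 2) * Z.W j j)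
    + ((Z.gt i i - 1 / 2) * (Z.b i i * (Z.gt i j - 1 / 2)
        + offDiag i j * Z.b i j * (Z.gt i j + Z.gt j i - 1))
      + (1 / 3 - Z.gt i i) * (1 / 2 * Z.gt j i + offDiag i j * Z.gt i j)
      + (1 / 6 * Z.gt i i - 1 / 24) * (1 + 2 * offDiag i j)) * Z.W i j

theorem modified_equation : (Z.h ^ 2 * Z.τ) • Z.φ
    = (Z.h ^ 2 * ∑ i, ((Z.gt i i - 1 / 2) * Z.W i i) • Z.del i ^ 2) • Z.φ
    + (Z.ξ • Z.h ^ 2) • Z.F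
    + (Z.h ^ 4 * ∑ i, ∑ j, Z.coef i j • (Z.del i ^ 2 * Z.del j ^ 2)) • Z.φ := by
  have h1 : -((1 / 2 : ℝ) • Z.opP ^ 2)
      + ∑ i, Z.del i ^ 2 * ((e2inv (Z.gt i i) (Z.b i i) * Z.W i i) • Z.opP + Z.opN i)
      = ∑ i, ∑ j, Z.coef i j • (Z.del i ^ 2 * Z.del j ^ 2) := by
    have h2 : Z.opP ^ 2 = ∑ i, (((Z.gt i i - 1 / 2) * Z.W i i) • Z.del i ^ 2) * Z.opP := by
      rw [← Finset.sum_mul, ← opP, sq]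
    rw [h2, Finset.smul_sum, ← Finset.sum_neg_distrib, ← Finset.sum_add_distrib]
    refine Finset.sum_congr rfl fun i _ => ?_
    simp only [opN, opG, opW, opK, opH, opM, opP, Finset.smul_sum, Finset.mul_sum,
      ← Finset.sum_add_distrib, ← Finset.sum_sub_distrib, ← Finset.sum_neg_distrib]
    refine Finset.sum_congr rfl fun j _ => ?_
    rw [coef]
    algebra
  rw [← h1, Z.modified_equation_op, opP]

end MomentSystem

/-! ### The lattice -/

theorem prod_pow_expo {d : ℕ} {M : Type*} [CommMonoid M] (x : Fin d → M) (m : Idx d) :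
    ∏ l, x l ^ expo m l = match m with
      | .inl _ => 1
      | .inr (.inl (i, b)) => x i ^ pw b
      | .inr (.inr (p, b, b')) => x p.1.1 ^ pw b * x p.1.2 ^ pw b' := by
  have hs : ∀ (i : Fin d) (n : ℕ), ∏ l, x l ^ (Pi.single i n : Fin d → ℕ) l = x i ^ n := by
    intro i n
    rw [Finset.prod_eq_single i]
    · simp
    · intro j _ hj
      simp [Pi.single_eq_of_ne hj]
    · simp
  rcases m with _ | ⟨i, b⟩ | ⟨p, b, b'⟩
  · simp [expo]
  · simpa only [expo] using hs _ _
  · simp only [expo, Pi.add_apply, pow_add, Finset.prod_mul_distrib, hs]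

/-- The monomial `m` evaluated at the lattice point `k`. -/
def mono {d : ℕ} (m k : Idx d) : ℝ := ∏ l, unitVel k l ^ expo m l

theorem transf_eq {d : ℕ} (c : ℝ) (m k : Idx d) :
    transf d c m k = c ^ (∑ l, expo m l) * mono m k := by
  simp only [transf, mono, mul_pow, Finset.prod_mul_distrib, Finset.prod_pow_eq_pow_sum]

theorem sgn_sq (b : Bool) : sgn b ^ 2 = 1 := by cases b <;> simp [sgn]

theorem sgn_mul_self (b : Bool) : sgn b * sgn b = 1 := by cases b <;> simp [sgn]

theorem unitVel_axis {d : ℕ} (i l : Fin d) (b : Bool) :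
    unitVel (.inr (.inl (i, b))) l = if i = l then sgn b else 0 := by
  simp [unitVel, Pi.single_apply, eq_comm]

theorem unitVel_diag {d : ℕ} (p : Pairs d) (b b' : Bool) (l : Fin d) :
    unitVel (.inr (.inr (p, b, b'))) l
      = if p.1.1 = l then sgn b else if p.1.2 = l then sgn b' else 0 := by
  have := p.2.ne
  simp only [unitVel, Pi.add_apply, Pi.single_apply, eq_comm (a := l)]
  split_ifs with h1 h2
  · exact absurd (h1.trans h2.symm) this
  · simp
  · simp
  · simp

theorem unitVel_cube {d : ℕ} (k : Idx d) (i : Fin d) : unitVel k i ^ 3 = unitVel k i := by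
  rcases k with _ | ⟨l, b⟩ | ⟨p, b, b'⟩
  · simp [unitVel]
  · rw [unitVel_axis]; split_ifs <;> simp [pow_succ, sgn_mul_self]
  · rw [unitVel_diag]; split_ifs <;> simp [pow_succ, sgn_mul_self]

theorem unitVel_mul {d : ℕ} (k : Idx d) (i j l : Fin d) (hij : i ≠ j) (hjl : j ≠ l)
    (hil : i ≠ l) : unitVel k i * unitVel k j * unitVel k l = 0 := by
  rcases k with _ | ⟨a, b⟩ | ⟨⟨⟨a, a'⟩, h⟩, b, b'⟩
  · simp [unitVel]
  · simp only [unitVel_axis]; grind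
  · simp only [unitVel_diag]; grind

/-! Invertibility of the transformation matrix. -/

theorem mono_axis_axis {d : ℕ} (i j : Fin d) (b c : Bool) :
    mono (.inr (.inl (i, b))) (.inr (.inl (j, c))) = if j = i then sgn c ^ pw b else 0 := by
  rw [mono, prod_pow_expo]
  simp only [unitVel_axis]
  split_ifs
  · rfl
  · cases b <;> simp [pw]

theorem mono_diag_axis {d : ℕ} (p : Pairs d) (j : Fin d) (b b' c : Bool) :
    mono (.inr (.inr (p, b, b'))) (.inr (.inl (j, c))) = 0 := by
  have := p.2.ne
  rw [mono, prod_pow_expo]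
  simp only [unitVel_axis]
  split_ifs with h1 h2
  · exact absurd (h1.symm.trans h2) this
  all_goals cases b <;> cases b' <;> simp [pw]

theorem mono_diag_diag {d : ℕ} (p q : Pairs d) (b b' c c' : Bool) :
    mono (.inr (.inr (p, b, b'))) (.inr (.inr (q, c, c')))
      = if q = p then sgn c ^ pw b * sgn c' ^ pw b' else 0 := by
  have hp := p.2
  have hq := q.2
  rw [mono, prod_pow_expo]
  simp only [unitVel_diag]
  obtain ⟨⟨a, a'⟩, ha⟩ := p
  obtain ⟨⟨e, e'⟩, he⟩ := q
  simp only [Subtype.mk.injEq, Prod.mk.injEq] at hp hq ⊢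
  have hpw : ∀ b, pw b ≠ 0 := by intro b; cases b <;> simp [pw]
  by_cases h : e = a ∧ e' = a'
  · obtain ⟨rfl, rfl⟩ := h
    simp [hq.ne]
  · rw [if_neg h]
    -- For distinct pairs, at least one index of the monomial is missing from the velocity. If `a`
    -- occurs then `a'` does not; the ordering of pairs excludes the swapped one.
    by_cases h1 : e = a ∨ e' = a
    · have h2 : e ≠ a' ∧ e' ≠ a' := by
        rcases h1 with rfl | rfl
        · exact ⟨hp.ne, fun h' => h ⟨rfl, h'⟩⟩
        · exact ⟨(hq.trans hp).ne, hp.ne⟩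
      simp [h2.1, h2.2, hpw]
    · push Not at h1
      simp [h1.1, h1.2, hpw]

theorem mono_one {d : ℕ} (u : Unit) (k : Idx d) : mono (.inl u) k = 1 := by
  rw [mono, prod_pow_expo]

theorem mono_axis_zero {d : ℕ} (i : Fin d) (b : Bool) (u : Unit) :
    mono (.inr (.inl (i, b))) (.inl u) = 0 := by
  rw [mono, prod_pow_expo]
  cases b <;> simp [pw, unitVel]

theorem mono_diag_zero {d : ℕ} (p : Pairs d) (b b' : Bool) (u : Unit) :
    mono (.inr (.inr (p, b, b'))) (.inl u) = 0 := by
  rw [mono, prod_pow_expo]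
  cases b <;> simp [pw, unitVel]

theorem sum_idx {d : ℕ} (G : Idx d → ℝ) : ∑ k, G k = G (.inl ())
    + ∑ i, (G (.inr (.inl (i, true))) + G (.inr (.inl (i, false))))
    + ∑ p, ((G (.inr (.inr (p, true, true))) + G (.inr (.inr (p, true, false))))
      + (G (.inr (.inr (p, false, true))) + G (.inr (.inr (p, false, false))))) := by
  rw [Fintype.sum_sum_type, Fintype.sum_sum_type, Fintype.sum_prod_type, Fintype.sum_prod_type,
    add_assoc]
  simp only [Fintype.sum_prod_type, Fintype.sum_bool]
  simp

/-- The system is block triangular in the support of the velocity: rest, axis and diagonal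
velocities successively isolate one block. Within a block, the possible signs determine all
coefficients. -/
theorem eq_zero_of_sum_mul_mono {d : ℕ} (v : Idx d → ℝ) (hv : ∀ k, ∑ m, v m * mono m k = 0) :
    v = 0 := by
  have h0 : v (.inl ()) = 0 := by
    have := hv (.inl ())
    rw [sum_idx] at this
    simpa [mono_one, mono_axis_zero, mono_diag_zero] using this
  have h1 : ∀ i b, v (.inr (.inl (i, b))) = 0 := by
    intro i
    have e : ∀ c, v (.inr (.inl (i, false))) * sgn c + v (.inr (.inl (i, true))) = 0 := by
      intro c
      have := hv (.inr (.inl (i, c)))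
      simp only [sum_idx, mono_one, mono_axis_axis, mono_diag_axis, h0] at this
      simp [pw, sgn_sq, Finset.sum_add_distrib] at this
      linarith
    have e1 := e true
    have e2 := e false
    simp only [sgn, if_true, Bool.false_eq_true, if_false] at e1 e2
    intro b
    cases b <;> linarith
  have h2 : ∀ p b b', v (.inr (.inr (p, b, b'))) = 0 := by
    intro p
    have e : ∀ c c', v (.inr (.inr (p, false, false))) * sgn c * sgn c'
        + v (.inr (.inr (p, true, false))) * sgn c' + v (.inr (.inr (p, false, true))) * sgn c
        + v (.inr (.inr (p, true, true))) = 0 := by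
      intro c c'
      have := hv (.inr (.inr (p, c, c')))
      simp only [sum_idx, mono_one, mono_diag_diag, h0, h1] at this
      simp [pw, sgn_sq, Finset.sum_add_distrib] at this
      linarith
    have e1 := e true true
    have e2 := e true false
    have e3 := e false true
    have e4 := e false false
    simp only [sgn, if_true, Bool.false_eq_true, if_false] at e1 e2 e3 e4
    intro b b'
    cases b <;> cases b' <;> linarith
  funext m
  rcases m with _ | ⟨i, b⟩ | ⟨p, b, b'⟩
  · exact h0
  · exact h1 i b
  · exact h2 p b b'

theorem isUnit_transf {d : ℕ} {c : ℝ} (hc : c ≠ 0) : IsUnit (transf d c) := by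
  rw [← Matrix.vecMul_injective_iff_isUnit]
  intro v w hvw
  rw [← sub_eq_zero]
  -- The lattice speed enters only as a nonzero power of `c` in each row, which is absorbed into the
  -- coefficients.
  have h : ∀ k, ∑ m, ((v - w) m * c ^ (∑ l, expo m l)) * mono m k = 0 := by
    intro k
    have := congrFun hvw k
    simp only [Matrix.vecMul, dotProduct, transf_eq] at this
    rw [← sub_eq_zero, ← Finset.sum_sub_distrib] at this
    rw [← this]
    refine Finset.sum_congr rfl fun m _ => ?_
    simp only [Pi.sub_apply]
    ring
  have h' := eq_zero_of_sum_mul_mono _ h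
  funext m
  exact (mul_eq_zero.1 (congrFun h' m)).resolve_right (pow_ne_zero _ hc)

/-- This is `M Λ = S M` read row by row, with the common power of the lattice speed cancelled: rows
of monomials are left eigenvectors of the collision matrix. -/
theorem sum_mono_mul_collision {d : ℕ} (P : Params d) (Δx : ℝ) (hc : P.speed Δx ≠ 0)
    (m j : Idx d) : ∑ k, mono m k * P.collision Δx k j = P.relax Δx m * mono m j := by
  have h : transf d (P.speed Δx) * P.collision Δx
      = Matrix.diagonal (P.relax Δx) * transf d (P.speed Δx) := by
    rw [Params.collision, Matrix.mul_assoc, Matrix.mul_nonsing_inv_cancel_left _ _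
      ((Matrix.isUnit_iff_isUnit_det _).1 (isUnit_transf hc))]
  have h' := congrFun (congrFun h m) j
  rw [Matrix.mul_apply, Matrix.diagonal_mul] at h'
  simp only [transf_eq, mul_assoc, ← Finset.mul_sum] at h'
  have hc' : P.speed Δx ^ (∑ l, expo m l) ≠ 0 := pow_ne_zero _ hc
  apply mul_left_cancel₀ hc'
  rw [h']; ring

/-! Moments of the weights. -/

/-- Reflection of the lattice which changes the sign of the coordinate `j`. -/
def reflect {d : ℕ} (j : Fin d) : Idx d → Idx d
  | .inl u => .inl u
  | .inr (.inl (i, b)) => .inr (.inl (i, if i = j then !b else b))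
  | .inr (.inr (p, b, b')) =>
    .inr (.inr (p, if p.1.1 = j then !b else b, if p.1.2 = j then !b' else b'))

theorem reflect_reflect {d : ℕ} (j : Fin d) (k : Idx d) : reflect j (reflect j k) = k := by
  rcases k with _ | ⟨i, b⟩ | ⟨p, b, b'⟩
  · rfl
  · simp only [reflect]; split_ifs <;> simp
  · simp only [reflect]; split_ifs <;> simp

theorem weight_reflect {d : ℕ} (P : Params d) (j : Fin d) (k : Idx d) :
    P.weight (reflect j k) = P.weight k := by
  rcases k with _ | ⟨i, b⟩ | ⟨p, b, b'⟩ <;> rfl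

theorem unitVel_reflect {d : ℕ} (j l : Fin d) (k : Idx d) :
    unitVel (reflect j k) l = (if l = j then -1 else 1) * unitVel k l := by
  have hs : ∀ b, sgn (!b) = - sgn b := by intro b; cases b <;> simp [sgn]
  rcases k with _ | ⟨i, b⟩ | ⟨p, b, b'⟩
  · simp [reflect, unitVel]
  · simp only [reflect, unitVel_axis]; grind
  · simp only [reflect, unitVel_diag]; grind

/-- The weights are invariant under reflection, so the sum equals its own negative. -/
theorem sum_weight_eq_zero {d : ℕ} (P : Params d) (j : Fin d) (q : Idx d → ℝ)
    (hq : ∀ k, q (reflect j k) = -q k) : ∑ k, P.weight k * q k = 0 := by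
  have h : ∑ k, P.weight k * q k = ∑ k, P.weight (reflect j k) * q (reflect j k) :=
    (Equiv.sum_comp (Function.Involutive.toPerm _ (reflect_reflect j))
      (fun k => P.weight k * q k)).symm
  simp only [weight_reflect, hq, mul_neg, Finset.sum_neg_distrib] at h
  linarith

theorem sum_pairs {d : ℕ} (G : Fin d → Fin d → ℝ) :
    ∑ p : Pairs d, G p.1.1 p.1.2 = ∑ i, ∑ j, if i < j then G i j else 0 := by
  rw [← Fintype.sum_prod_type', ← Finset.sum_filter]
  exact (Finset.sum_subtype _ (by simp) (fun q : Fin d × Fin d => G q.1 q.2)).symm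

theorem sum_weight {d : ℕ} (P : Params d) : ∑ k, P.weight k = 1 := by
  have hc : ((Fintype.card (Pairs d) : ℕ) : ℝ) = d * (d - 1) / 2 := by
    have := card_idx d
    simp only [Fintype.card_sum, Fintype.card_prod, Fintype.card_unit, Fintype.card_bool,
      Fintype.card_fin] at this
    have h : ((1 + (d * 2 + Fintype.card (Pairs d) * (2 * 2)) : ℕ) : ℝ) = ((2 * d ^ 2 + 1 : ℕ) : ℝ) := by
      rw [this]
    push_cast at h
    linarith
  rw [sum_idx]
  simp only [Params.weight, Finset.sum_const, Finset.card_univ, nsmul_eq_mul, hc,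
    Finset.sum_add_distrib]
  ring

/-- Fourth moments of the weights. -/
def Params.mom4 {d : ℕ} (P : Params d) (i j : Fin d) : ℝ := if i = j then P.A i else 4 * P.wd

theorem sum_weight_sq_mul_sq {d : ℕ} (P : Params d) (i j : Fin d) :
    ∑ k, P.weight k * (unitVel k i ^ 2 * unitVel k j ^ 2) = P.mom4 i j := by
  have h1 : ∀ (p : Pairs d) (b b' : Bool) (l : Fin d),
      unitVel (.inr (.inr (p, b, b'))) l ^ 2
        = (if p.1.1 = l then 1 else 0) + if p.1.2 = l then 1 else 0 := by
    intro p b b' l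
    have := p.2.ne
    rw [unitVel_diag]
    split_ifs with h1 h2
    · exact absurd (h1.trans h2.symm) this
    all_goals simp [sgn_sq]
  have h2 : ∀ (a : Fin d) (b : Bool) (l : Fin d),
      unitVel (.inr (.inl (a, b))) l ^ 2 = if a = l then 1 else 0 := by
    intro a b l
    rw [unitVel_axis]
    split_ifs <;> simp [sgn_sq]
  -- Counts the pairs containing both `i` and `j`: there are `d - 1` if the two agree and one
  -- otherwise. Each pair carries four diagonal velocities.
  have h3 : ∑ p : Pairs d, (((if p.1.1 = i then (1 : ℝ) else 0) + if p.1.2 = i then 1 else 0) *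
      ((if p.1.1 = j then 1 else 0) + if p.1.2 = j then 1 else 0))
      = if i = j then (d : ℝ) - 1 else 1 := by
    rw [sum_pairs (fun a b => ((if a = i then (1 : ℝ) else 0) + if b = i then 1 else 0) *
      ((if a = j then 1 else 0) + if b = j then 1 else 0))]
    by_cases hij : i = j
    · subst hij
      have e : ∀ a b : Fin d, (if a < b then ((if a = i then (1 : ℝ) else 0) + if b = i then 1 else 0)
          * ((if a = i then 1 else 0) + if b = i then 1 else 0) else 0)
          = (if a = i then if i < b then 1 else 0 else 0)
            + if b = i then if a < i then 1 else 0 else 0 := by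
        intro a b
        split_ifs <;> first | omega | norm_num
      simp only [e, Finset.sum_add_distrib, Finset.sum_ite_eq', Finset.mem_univ, if_true]
      rw [Finset.sum_comm]
      simp only [Finset.sum_ite_eq', Finset.mem_univ, if_true, Finset.sum_boole]
      have c1 : (Finset.univ.filter fun x : Fin d => i < x) = Finset.Ioi i := by ext; simp
      have c2 : (Finset.univ.filter fun x : Fin d => x < i) = Finset.Iio i := by ext; simp
      rw [c1, c2, Fin.card_Ioi, Fin.card_Iio, ← Nat.cast_add]
      have := i.2
      rw [show d - 1 - (i : ℕ) + i = d - 1 by omega, Nat.cast_sub (by omega), Nat.cast_one]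
    · have e : ∀ a b : Fin d, (if a < b then ((if a = i then (1 : ℝ) else 0) + if b = i then 1 else 0)
          * ((if a = j then 1 else 0) + if b = j then 1 else 0) else 0)
          = (if a = i then if b = j then if i < j then 1 else 0 else 0 else 0)
            + if a = j then if b = i then if j < i then 1 else 0 else 0 else 0 := by
        intro a b
        split_ifs <;> first | omega | norm_num
      simp only [e, Finset.sum_add_distrib, Finset.sum_ite_irrel, Finset.sum_ite_eq',
        Finset.mem_univ, if_true, Finset.sum_const_zero, hij, if_false]
      split_ifs <;> first | omega | norm_num
  rw [sum_idx]
  simp only [Params.weight, h1, h2]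
  simp only [← two_mul, ← Finset.mul_sum, h3, Params.mom4]
  by_cases hij : i = j
  · subst hij
    simp [unitVel, Params.A]
    ring
  · simp [unitVel, hij, Ne.symm hij]
    ring

open Set Filter Topology TopologicalSpace

/-! ### Families of smooth functions -/

/-- Space-time points. -/
abbrev Pt (d : ℕ) := (Fin d → ℝ) × ℝ

/-- The algebra of bounded functions of the mesh size. -/
def bddSubalgebra (I : Type) : Subalgebra ℝ (I → ℝ) where
  carrier := {c | ∃ C, ∀ i, |c i| ≤ C}
  mul_mem' := by
    rintro a b ⟨A, hA⟩ ⟨B, hB⟩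
    refine ⟨A * B, fun i => ?_⟩
    rw [Pi.mul_apply, abs_mul]
    exact mul_le_mul (hA i) (hB i) (abs_nonneg _) ((abs_nonneg _).trans (hA i))
  add_mem' := by
    rintro a b ⟨A, hA⟩ ⟨B, hB⟩
    exact ⟨A + B, fun i => (abs_add_le _ _).trans (add_le_add (hA i) (hB i))⟩
  algebraMap_mem' := fun r => ⟨|r|, fun i => le_of_eq (by simp)⟩

/-- The type of bounded functions of the mesh size. -/
def bddFun (I : Type) : Type := bddSubalgebra I

instance (I : Type) : CommRing (bddFun I) := inferInstanceAs (CommRing (bddSubalgebra I))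

instance (I : Type) : Algebra ℝ (bddFun I) := inferInstanceAs (Algebra ℝ (bddSubalgebra I))

namespace bddFun

variable {I : Type}

/-- The underlying function. -/
def val (c : bddFun I) : I → ℝ := Subtype.val c

/-- A bounded function as an element of `bddFun`. -/
def of (c : I → ℝ) (hc : ∃ C, ∀ i, |c i| ≤ C) : bddFun I := ⟨c, hc⟩

theorem of_val (c : I → ℝ) (hc : ∃ C, ∀ i, |c i| ≤ C) (i : I) : (of c hc).val i = c i := rfl

theorem exists_bound (c : bddFun I) : ∃ C, ∀ i, |c.val i| ≤ C := Subtype.property c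

theorem ext_val {a b : bddFun I} (h : ∀ i, a.val i = b.val i) : a = b := Subtype.ext (funext h)

theorem pow_val (a : bddFun I) (n : ℕ) (i : I) : (a ^ n).val i = a.val i ^ n := rfl

end bddFun

/-- Families of functions which are smooth on the open sets `U i` and vanish outside of them. -/
def famSubmodule {I : Type} {d : ℕ} (U : I → Opens (Pt d)) : Submodule (I → ℝ) (I → Pt d → ℝ) where
  carrier := {u | ∀ i, ContDiffOn ℝ (⊤ : ℕ∞) (u i) (U i) ∧ ∀ z, z ∉ U i → u i z = 0}
  add_mem' := by
    intro u v hu hv i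
    exact ⟨(hu i).1.add (hv i).1, fun z hz => by simp [(hu i).2 z hz, (hv i).2 z hz]⟩
  zero_mem' := fun i => ⟨contDiffOn_const, fun z _ => rfl⟩
  smul_mem' := by
    intro c u hu i
    exact ⟨(hu i).1.const_smul (c i), fun z hz => by simp [(hu i).2 z hz]⟩

/-- The type of families of functions which are smooth on `U i` and vanish outside of `U i`. -/
def Fam {I : Type} {d : ℕ} (U : I → Opens (Pt d)) : Type := famSubmodule U

instance {I : Type} {d : ℕ} (U : I → Opens (Pt d)) : AddCommGroup (Fam U) :=
  inferInstanceAs (AddCommGroup (famSubmodule U))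

instance {I : Type} {d : ℕ} (U : I → Opens (Pt d)) : Module (bddFun I) (Fam U) :=
  inferInstanceAs (Module (bddSubalgebra I) (famSubmodule U))

open scoped IsMulCommutative in
/-- Evaluation of polynomials at commuting elements of an algebra. -/
def evalComm {K A σ : Type*} [CommRing K] [Ring A] [Algebra K A] (f : σ → A)
    (h : ∀ s t, f s * f t = f t * f s) : MvPolynomial σ K →ₐ[K] A :=
  haveI := Algebra.isMulCommutative_adjoin K (s := Set.range f)
    (by rintro _ ⟨s, rfl⟩ _ ⟨t, rfl⟩; exact h s t)
  (Algebra.adjoin K (Set.range f)).val.comp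
    (MvPolynomial.aeval (R := K) (S₁ := Algebra.adjoin K (Set.range f))
      fun s => ⟨f s, Algebra.subset_adjoin ⟨s, rfl⟩⟩)

open scoped IsMulCommutative in
theorem evalComm_X {K A σ : Type*} [CommRing K] [Ring A] [Algebra K A] (f : σ → A)
    (h : ∀ s t, f s * f t = f t * f s) (s : σ) :
    evalComm (K := K) f h (MvPolynomial.X s) = f s := by
  simp [evalComm]

/-- Coordinate directions of space-time; `none` is time. -/
def dir {d : ℕ} : Option (Fin d) → Pt d
  | none => (0, 1)
  | some i => (Pi.single i 1, 0)

/-- Differential operators with coefficients depending on the mesh size. -/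
abbrev DiffOp (I : Type) (d : ℕ) := MvPolynomial (Option (Fin d)) (bddFun I)

namespace Fam

variable {I : Type} {d : ℕ} {U V : I → Opens (Pt d)}

/-- The members of a family. -/
def val (u : Fam U) : I → Pt d → ℝ := Subtype.val u

theorem add_apply (u v : Fam U) (i : I) (z : Pt d) : (u + v).val i z = u.val i z + v.val i z := rfl

theorem sub_apply (u v : Fam U) (i : I) (z : Pt d) : (u - v).val i z = u.val i z - v.val i z := rfl

theorem zero_apply (i : I) (z : Pt d) : (0 : Fam U).val i z = 0 := rfl

theorem smul_apply (c : bddFun I) (u : Fam U) (i : I) (z : Pt d) :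
    (c • u).val i z = c.val i * u.val i z := rfl

theorem contDiffOn (u : Fam U) (i : I) : ContDiffOn ℝ (⊤ : ℕ∞) (u.val i) (U i) := (u.2 i).1

theorem contDiffAt (u : Fam U) (i : I) {z : Pt d} (hz : z ∈ U i) :
    ContDiffAt ℝ (⊤ : ℕ∞) (u.val i) z :=
  (u.contDiffOn i).contDiffAt ((U i).isOpen.mem_nhds hz)

theorem differentiableAt (u : Fam U) (i : I) {z : Pt d} (hz : z ∈ U i) :
    DifferentiableAt ℝ (u.val i) z :=
  (u.contDiffAt i hz).differentiableAt (by simp)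

theorem apply_of_notMem (u : Fam U) (i : I) {z : Pt d} (hz : z ∉ U i) : u.val i z = 0 :=
  (u.2 i).2 z hz

/-- Because members vanish off `U`, equality as elements of the module is equality on `U` alone.
This is the purpose of extending by zero. -/
theorem ext_on {u v : Fam U} (h : ∀ i, ∀ z ∈ U i, u.val i z = v.val i z) : u = v := by
  refine Subtype.ext (funext fun i => funext fun z => ?_)
  by_cases hz : z ∈ U i
  · exact h i z hz
  · exact (u.apply_of_notMem i hz).trans (v.apply_of_notMem i hz).symm

open Classical in
/-- The family with given values on `U`. -/
def mk' (f : I → Pt d → ℝ) (hf : ∀ i, ContDiffOn ℝ (⊤ : ℕ∞) (f i) (U i)) : Fam U :=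
  ⟨fun i z => if z ∈ U i then f i z else 0, fun i =>
    ⟨(hf i).congr fun _ hz => if_pos hz, fun _ hz => if_neg hz⟩⟩

theorem mk'_apply (f : I → Pt d → ℝ) (hf : ∀ i, ContDiffOn ℝ (⊤ : ℕ∞) (f i) (U i)) (i : I)
    {z : Pt d} (hz : z ∈ U i) : (mk' f hf).val i z = f i z := if_pos hz

theorem fderiv_congr (u : Fam U) {i : I} {g : Pt d → ℝ} (h : ∀ z ∈ U i, u.val i z = g z)
    {z : Pt d} (hz : z ∈ U i) : fderiv ℝ (u.val i) z = fderiv ℝ g z :=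
  Filter.EventuallyEq.fderiv_eq (((U i).isOpen.eventually_mem hz).mono h)

/-- Directional derivative. -/
def deriv (v : Pt d) : Fam U →ₗ[bddFun I] Fam U where
  toFun u := mk' (fun i z => fderiv ℝ (u.val i) z v) fun i =>
    ((u.contDiffOn i).fderiv_of_isOpen (U i).isOpen (by simp)).clm_apply contDiffOn_const
  map_add' u w := by
    refine ext_on fun i z hz => ?_
    rw [mk'_apply _ _ _ hz, add_apply]
    show fderiv ℝ (u.val i + w.val i) z v = _
    rw [mk'_apply _ _ _ hz, mk'_apply _ _ _ hz,
      fderiv_add (u.differentiableAt i hz) (w.differentiableAt i hz)]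
    rfl
  map_smul' c u := by
    refine ext_on fun i z hz => ?_
    rw [mk'_apply _ _ _ hz, RingHom.id_apply, smul_apply]
    show fderiv ℝ (c.val i • u.val i) z v = _
    rw [mk'_apply _ _ _ hz, fderiv_const_smul (u.differentiableAt i hz)]
    rfl

theorem deriv_apply (v : Pt d) (u : Fam U) {i : I} {z : Pt d} (hz : z ∈ U i) :
    (deriv v u).val i z = fderiv ℝ (u.val i) z v := if_pos hz

/-- Symmetry of the second derivative. It is what makes the polynomial ring act on families. -/
theorem deriv_comm (v w : Pt d) (u : Fam U) : deriv v (deriv w u) = deriv w (deriv v u) := by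
  have h : ∀ v w : Pt d, ∀ i, ∀ z ∈ U i, (deriv v (deriv w u)).val i z
      = fderiv ℝ (fderiv ℝ (u.val i)) z v w := by
    intro v w i z hz
    rw [deriv_apply _ _ hz, fderiv_congr _ (fun _ hz => deriv_apply w u hz) hz]
    have : DifferentiableAt ℝ (fderiv ℝ (u.val i)) z :=
      ((u.contDiffAt i hz).fderiv_right (m := 1) (by norm_cast)).differentiableAt (by simp)
    rw [fderiv_clm_apply this (differentiableAt_const w)]
    simp
  refine ext_on fun i z hz => ?_
  rw [h _ _ _ _ hz, h _ _ _ _ hz]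
  have := (u.contDiffAt i hz).isSymmSndFDerivAt (by simp; norm_cast)
  exact this v w

/-- The action of differential operators on families. -/
def action (U : I → Opens (Pt d)) : DiffOp I d →+* Module.End (bddFun I) (Fam U) :=
  (evalComm (K := bddFun I) (A := Module.End (bddFun I) (Fam U)) (fun s => deriv (dir s))
    fun _ _ => LinearMap.ext fun u => deriv_comm _ _ u).toRingHom

instance : Module (DiffOp I d) (Fam U) := Module.compHom _ (action U)

theorem X_smul (s : Option (Fin d)) (u : Fam U) :
    (MvPolynomial.X s : DiffOp I d) • u = deriv (dir s) u := by
  show action U (MvPolynomial.X s) u = _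
  simp [action, evalComm_X]

theorem C_smul (c : bddFun I) (u : Fam U) : (MvPolynomial.C c : DiffOp I d) • u = c • u := by
  show action U (MvPolynomial.C c) u = _
  simp only [action, AlgHom.toRingHom_eq_coe, RingHom.coe_coe]
  rw [← MvPolynomial.algebraMap_eq, AlgHom.commutes]
  rfl

theorem C_smul_apply (c : bddFun I) (u : Fam U) (i : I) (z : Pt d) :
    ((MvPolynomial.C c : DiffOp I d) • u).val i z = c.val i * u.val i z := by
  rw [C_smul]; rfl

theorem sum_apply {α : Type*} (s : Finset α) (u : α → Fam U) (i : I) (z : Pt d) :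
    (∑ a ∈ s, u a).val i z = ∑ a ∈ s, (u a).val i z := by
  let ev : Fam U →+ ℝ := { toFun := fun u => u.val i z, map_zero' := rfl, map_add' := fun _ _ => rfl }
  exact map_sum ev u s

theorem real_smul_apply (c : ℝ) (r : DiffOp I d) (u : Fam U) (i : I) (z : Pt d) :
    ((c • r) • u).val i z = c * (r • u).val i z := by
  have : c • r = MvPolynomial.C (algebraMap ℝ (bddFun I) c) * r := by
    rw [Algebra.smul_def]; rfl
  rw [this, mul_smul, C_smul_apply]
  rfl

/-- Translation of a family. -/
def shiftFun (δ : I → Pt d) (hδ : ∀ i, ∀ z ∈ U i, z + δ i ∈ V i) (u : Fam V) : Fam U :=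
  mk' (fun i z => u.val i (z + δ i)) fun i =>
    (u.contDiffOn i).comp (contDiff_id.add contDiff_const).contDiffOn fun z hz => hδ i z hz

theorem shiftFun_apply (δ : I → Pt d) (hδ : ∀ i, ∀ z ∈ U i, z + δ i ∈ V i) (u : Fam V) {i : I}
    {z : Pt d} (hz : z ∈ U i) : (shiftFun δ hδ u).val i z = u.val i (z + δ i) := if_pos hz

/-- Translation commutes with differential operators. -/
def shift (δ : I → Pt d) (hδ : ∀ i, ∀ z ∈ U i, z + δ i ∈ V i) : Fam V →ₗ[DiffOp I d] Fam U where
  toFun := shiftFun δ hδ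
  map_add' u w := by
    refine ext_on fun i z hz => ?_
    rw [shiftFun_apply _ _ _ hz, add_apply, add_apply, shiftFun_apply _ _ _ hz,
      shiftFun_apply _ _ _ hz]
  map_smul' r u := by
    rw [RingHom.id_apply]
    induction r using MvPolynomial.induction_on generalizing u with
    | C c =>
      refine ext_on fun i z hz => ?_
      rw [shiftFun_apply _ _ _ hz, C_smul_apply, C_smul_apply, shiftFun_apply _ _ _ hz]
    | add p q hp hq =>
      rw [add_smul p q (shiftFun δ hδ u), ← hp, ← hq]
      refine ext_on fun i z hz => ?_
      rw [shiftFun_apply _ _ _ hz, add_smul, add_apply, add_apply, shiftFun_apply _ _ _ hz,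
        shiftFun_apply _ _ _ hz]
    | mul_X p s hp =>
      rw [mul_smul, mul_smul, hp]
      congr 1
      refine ext_on fun i z hz => ?_
      rw [shiftFun_apply _ _ _ hz, X_smul, X_smul, deriv_apply _ _ hz, deriv_apply _ _ (hδ i z hz),
        fderiv_congr _ (fun _ hz => shiftFun_apply δ hδ u hz) hz, fderiv_comp_add_right]

theorem shift_apply (δ : I → Pt d) (hδ : ∀ i, ∀ z ∈ U i, z + δ i ∈ V i) (u : Fam V) {i : I}
    {z : Pt d} (hz : z ∈ U i) : (shift δ hδ u).val i z = u.val i (z + δ i) :=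
  shiftFun_apply δ hδ u hz

/-- Families all of whose derivatives are bounded. -/
def bdd (U : I → Opens (Pt d)) : Submodule (DiffOp I d) (Fam U) where
  carrier := {u | ∀ r : DiffOp I d, ∃ C, ∀ i z, |(r • u).val i z| ≤ C}
  add_mem' := by
    intro u v hu hv r
    obtain ⟨A, hA⟩ := hu r
    obtain ⟨B, hB⟩ := hv r
    refine ⟨A + B, fun i z => ?_⟩
    rw [smul_add]
    exact (abs_add_le _ _).trans (add_le_add (hA i z) (hB i z))
  zero_mem' := fun r => ⟨0, fun i z => by rw [smul_zero, zero_apply, abs_zero]⟩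
  smul_mem' := by
    intro r u hu s
    obtain ⟨A, hA⟩ := hu (s * r)
    exact ⟨A, fun i z => by rw [← mul_smul]; exact hA i z⟩

theorem shift_mem_bdd (δ : I → Pt d) (hδ : ∀ i, ∀ z ∈ U i, z + δ i ∈ V i) {u : Fam V}
    (hu : u ∈ bdd V) : shift δ hδ u ∈ bdd U := by
  intro r
  obtain ⟨C, hC⟩ := hu r
  refine ⟨max C 0, fun i z => ?_⟩
  rw [← map_smul]
  by_cases hz : z ∈ U i
  · rw [shift_apply _ _ _ hz]; exact (hC i _).trans (le_max_left _ _)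
  · rw [apply_of_notMem _ _ hz]; simp

theorem mem_bdd_of_iteratedFDeriv (u : Fam U)
    (hu : ∀ n : ℕ, ∃ C : ℝ, ∀ i, ∀ z ∈ U i, ‖iteratedFDeriv ℝ n (u.val i) z‖ ≤ C) : u ∈ bdd U := by
  intro r
  -- The bound is strengthened to all iterated derivatives, so that induction on the operator can
  -- trade each factor `∂_s` for one more order of differentiation.
  suffices h : ∀ n : ℕ, ∃ C : ℝ, ∀ i, ∀ z ∈ U i, ‖iteratedFDeriv ℝ n ((r • u).val i) z‖ ≤ C by
    obtain ⟨C, hC⟩ := h 0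
    refine ⟨max C 0, fun i z => ?_⟩
    by_cases hz : z ∈ U i
    · have := hC i z hz
      rw [norm_iteratedFDeriv_zero] at this
      exact this.trans (le_max_left _ _)
    · rw [apply_of_notMem _ _ hz]; simp
  have hsm : ∀ (w : Fam U) (n : ℕ) i, ∀ z ∈ U i, ContDiffAt ℝ n (w.val i) z := fun w n i z hz =>
    (w.contDiffAt i hz).of_le (by exact_mod_cast le_top)
  induction r using MvPolynomial.induction_on generalizing u with
  | C c =>
    intro n
    obtain ⟨C, hC⟩ := hu n
    obtain ⟨A, hA⟩ := c.exists_bound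
    refine ⟨A * C, fun i z hz => ?_⟩
    have : ((MvPolynomial.C c : DiffOp I d) • u).val i = c.val i • u.val i := by
      rw [C_smul]; rfl
    rw [this, iteratedFDeriv_const_smul_apply (hsm u n i z hz), norm_smul]
    exact mul_le_mul (hA i) (hC i z hz) (norm_nonneg _) ((abs_nonneg _).trans (hA i))
  | add p q hp hq =>
    intro n
    obtain ⟨A, hA⟩ := hp u hu n
    obtain ⟨B, hB⟩ := hq u hu n
    refine ⟨A + B, fun i z hz => ?_⟩
    have : ((p + q) • u).val i = (p • u).val i + (q • u).val i := by rw [add_smul]; rfl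
    rw [this, iteratedFDeriv_add_apply (hsm _ n i z hz) (hsm _ n i z hz)]
    exact (norm_add_le _ _).trans (add_le_add (hA i z hz) (hB i z hz))
  | mul_X p s hp =>
    rw [mul_smul]
    refine hp _ fun n => ?_
    obtain ⟨C, hC⟩ := hu (n + 1)
    refine ⟨‖dir (d := d) s‖ * C, fun i z hz => ?_⟩
    have h1 : (deriv (dir s) u).val i =ᶠ[𝓝 z] fun z => fderiv ℝ (u.val i) z (dir s) :=
      ((U i).isOpen.eventually_mem hz).mono fun y hy => deriv_apply _ _ hy
    rw [X_smul, (Filter.EventuallyEq.iteratedFDeriv ℝ h1 n).eq_of_nhds]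
    have h2 : ContDiffAt ℝ n (fderiv ℝ (u.val i)) z :=
      (u.contDiffAt i hz).fderiv_right (by exact_mod_cast le_top)
    refine (norm_iteratedFDeriv_clm_apply_const h2 (le_refl _)).trans ?_
    rw [norm_iteratedFDeriv_fderiv]
    exact mul_le_mul_of_nonneg_left (hC i z hz) (norm_nonneg _)

end Fam

/-! ### Taylor expansion of translations -/

/-- The derivative of the remainder is the remainder for the shifted sequence `G (n + 1)`, so
induction and the mean value inequality apply. The usual factorial in the bound is not needed. -/
theorem abs_sub_taylor_le (N : ℕ) (G : ℕ → ℝ → ℝ) (M : ℝ)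
    (hG : ∀ n, ∀ s ∈ Icc (0 : ℝ) 1, HasDerivAt (G n) (G (n + 1) s) s)
    (hM : ∀ s ∈ Icc (0 : ℝ) 1, |G N s| ≤ M) (s : ℝ) (hs : s ∈ Icc (0 : ℝ) 1) :
    |G 0 s - ∑ n ∈ Finset.range N, G n 0 * (s ^ n / n.factorial)| ≤ M := by
  induction N generalizing G s with
  | zero => simpa using hM s hs
  | succ N ih =>
    have hM0 : 0 ≤ M := (abs_nonneg _).trans (hM 0 (by simp))
    have h1 := ih (fun n => G (n + 1)) (fun n => hG (n + 1)) hM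
    set R : ℝ → ℝ := fun s => G 0 s - ∑ n ∈ Finset.range (N + 1), G n 0 * (s ^ n / n.factorial)
      with hR
    have hd : ∀ x ∈ Icc (0 : ℝ) 1, HasDerivWithinAt R
        (G 1 x - ∑ n ∈ Finset.range N, G (n + 1) 0 * (x ^ n / n.factorial)) (Icc 0 1) x := by
      intro x hx
      refine HasDerivAt.hasDerivWithinAt (HasDerivAt.sub (hG 0 x hx) ?_)
      simp only [Finset.sum_range_succ', pow_zero]
      refine HasDerivAt.add_const _ ?_
      refine HasDerivAt.fun_sum fun n _ => HasDerivAt.const_mul _ ?_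
      have := ((hasDerivAt_pow (n + 1) x).div_const ((n + 1).factorial : ℝ))
      convert this using 1
      rw [Nat.factorial_succ]
      push_cast
      have : (n.factorial : ℝ) ≠ 0 := by exact_mod_cast n.factorial_ne_zero
      have : (n : ℝ) + 1 ≠ 0 := by positivity
      field_simp
    have h2 := (convex_Icc (0 : ℝ) 1).norm_image_sub_le_of_norm_hasDerivWithin_le hd
      (fun x hx => by rw [Real.norm_eq_abs]; exact h1 x hx) (by simp : (0 : ℝ) ∈ Icc (0 : ℝ) 1) hs
    have hR0 : R 0 = 0 := by
      simp [hR, Finset.sum_range_succ']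
    rw [hR0, sub_zero, sub_zero, Real.norm_eq_abs, Real.norm_eq_abs, abs_of_nonneg hs.1] at h2
    exact h2.trans (mul_le_of_le_one_right hM0 hs.2)

namespace Fam

variable {I : Type} {d : ℕ} {U V : I → Opens (Pt d)}

theorem C_mul_smul_apply (c : bddFun I) (r : DiffOp I d) (u : Fam U) (i : I) (z : Pt d) :
    ((MvPolynomial.C c * r) • u).val i z = c.val i * (r • u).val i z := by
  rw [mul_smul, C_smul_apply]

theorem C_pow_smul_apply (c : bddFun I) (n : ℕ) (u : Fam U) (i : I) (z : Pt d) :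
    ((MvPolynomial.C c ^ n : DiffOp I d) • u).val i z = c.val i ^ n * u.val i z := by
  rw [← map_pow, C_smul_apply, bddFun.pow_val]

theorem exists_eq_pow_smul (h : bddFun I) (hpos : ∀ i, 0 < h.val i) (n : ℕ) (y : Fam U)
    (hy : ∀ r : DiffOp I d, ∃ C, ∀ i z, |(r • y).val i z| ≤ C * h.val i ^ n) :
    ∃ w ∈ bdd U, y = (MvPolynomial.C h ^ n : DiffOp I d) • w := by
  -- Since `h` does not depend on the space-time point, dividing by `h ^ n` commutes with all
  -- derivatives, and the assumed bounds become the boundedness of `w`.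
  let w : Fam U := mk' (fun i z => (h.val i ^ n)⁻¹ * y.val i z) fun i =>
    contDiffOn_const.mul (y.contDiffOn i)
  have hw : y = (MvPolynomial.C h ^ n : DiffOp I d) • w := by
    refine ext_on fun i z hz => ?_
    have := (pow_pos (hpos i) n).ne'
    rw [C_pow_smul_apply, mk'_apply _ _ _ hz]
    field_simp
  refine ⟨w, fun r => ?_, hw⟩
  obtain ⟨C, hC⟩ := hy r
  refine ⟨C, fun i z => ?_⟩
  have h1 := hC i z
  have h2 := pow_pos (hpos i) n
  rw [hw, smul_comm, C_pow_smul_apply, abs_mul, abs_of_pos h2, mul_comm] at h1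
  exact le_of_mul_le_mul_right h1 h2

theorem shift_eq_taylor (δ : I → Pt d)
    (hδ : ∀ i, ∀ z ∈ U i, ∀ s ∈ Icc (0 : ℝ) 1, z + s • δ i ∈ V i)
    (hδ1 : ∀ i, ∀ z ∈ U i, z + δ i ∈ V i) (hδ0 : ∀ i, ∀ z ∈ U i, z + 0 ∈ V i)
    (h : bddFun I) (hpos : ∀ i, 0 < h.val i) (L : DiffOp I d)
    (hL : ∀ (u : Fam V) (i : I), ∀ z ∈ V i,
      ((MvPolynomial.C h * L) • u).val i z = fderiv ℝ (u.val i) z (δ i))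
    (N : ℕ) (u : Fam V) (hu : u ∈ bdd V) : ∃ w ∈ bdd U, shift δ hδ1 u
      = (∑ n ∈ Finset.range N, (1 / n.factorial : ℝ) • (MvPolynomial.C h * L) ^ n)
          • shift (fun _ => 0) hδ0 u + (MvPolynomial.C h ^ N : DiffOp I d) • w := by
  set T : DiffOp I d := ∑ n ∈ Finset.range N, (1 / n.factorial : ℝ) • (MvPolynomial.C h * L) ^ n
    with hT
  have key : ∀ u ∈ bdd V, ∃ C, ∀ i, ∀ z ∈ U i,
      |(shift δ hδ1 u - T • shift (fun _ => 0) hδ0 u).val i z| ≤ C * h.val i ^ N := by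
    intro u hu
    obtain ⟨C, hC⟩ := hu (L ^ N)
    refine ⟨C, fun i z hz => ?_⟩
    -- Along the segment from `z` to `z + δ`, differentiating in `s` is applying `h L`. Its `N`th
    -- power contributes the factor `h ^ N` of the remainder.
    have hd : ∀ n, ∀ s ∈ Icc (0 : ℝ) 1,
        HasDerivAt (fun s => (((MvPolynomial.C h * L) ^ n) • u).val i (z + s • δ i))
          ((((MvPolynomial.C h * L) ^ (n + 1)) • u).val i (z + s • δ i)) s := by
      intro n s hs
      have hz' := hδ i z hz s hs
      rw [pow_succ', mul_smul, hL _ _ _ hz']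
      have h1 : HasDerivAt (fun s : ℝ => z + s • δ i) (δ i) s := by
        simpa using ((hasDerivAt_id s).smul_const (δ i)).const_add z
      exact HasFDerivAt.comp_hasDerivAt s
        (differentiableAt (((MvPolynomial.C h * L) ^ n) • u) i hz').hasFDerivAt h1
    have hM : ∀ s ∈ Icc (0 : ℝ) 1,
        |(((MvPolynomial.C h * L) ^ N) • u).val i (z + s • δ i)| ≤ C * h.val i ^ N := by
      intro s hs
      have h2 := pow_pos (hpos i) N
      rw [mul_pow, mul_smul, C_pow_smul_apply, abs_mul, abs_of_pos h2, mul_comm]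
      exact mul_le_mul_of_nonneg_right (hC i _) h2.le
    have h3 := abs_sub_taylor_le N
      (fun n s => (((MvPolynomial.C h * L) ^ n) • u).val i (z + s • δ i)) _ hd hM 1 (by simp)
    rw [sub_apply, ← map_smul, shift_apply _ _ _ hz, shift_apply _ _ _ hz, hT, Finset.sum_smul,
      sum_apply]
    simp only [pow_zero, one_smul, zero_smul, add_zero, one_pow, real_smul_apply] at h3 ⊢
    convert h3 using 4
    ring
  obtain ⟨w, hw, e⟩ := exists_eq_pow_smul h hpos N (shift δ hδ1 u - T • shift (fun _ => 0) hδ0 u) <| by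
    -- The remainder for `r • u` is `r` applied to the remainder for `u`, because translations
    -- commute with differential operators. Hence all derivatives of the remainder are of order `h ^
    -- N` too.
    intro r
    obtain ⟨C, hC⟩ := key (r • u) (Submodule.smul_mem _ _ hu)
    refine ⟨max C 0, fun i z => ?_⟩
    have h2 := (pow_pos (hpos i) N).le
    by_cases hz : z ∈ U i
    · have := hC i z hz
      rw [map_smul, map_smul, smul_comm T r, ← smul_sub] at this
      exact this.trans (mul_le_mul_of_nonneg_right (le_max_left _ _) h2)
    · rw [apply_of_notMem _ _ hz, abs_zero]
      positivity
  exact ⟨w, hw, by rw [← e]; abel⟩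

theorem X_smul_apply_of_eqOn (s : Option (Fin d)) (u : Fam U) {i : I} {g : Pt d → ℝ}
    (h : ∀ z ∈ U i, u.val i z = g z) : ∀ z ∈ U i,
    ((MvPolynomial.X s : DiffOp I d) • u).val i z = fderiv ℝ g z (dir s) := by
  intro z hz
  rw [X_smul, deriv_apply _ _ hz, fderiv_congr u h hz]

/-- The family of constant functions `1`. -/
def one (U : I → Opens (Pt d)) : Fam U := mk' (fun _ _ => 1) fun _ => contDiffOn_const

theorem one_apply {i : I} {z : Pt d} (hz : z ∈ U i) : (one U).val i z = 1 := mk'_apply _ _ _ hz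

theorem X_smul_one (s : Option (Fin d)) : (MvPolynomial.X s : DiffOp I d) • one U = 0 := by
  refine ext_on fun i z hz => ?_
  rw [X_smul_apply_of_eqOn s _ (fun z hz => one_apply hz) z hz]
  simp [zero_apply]

theorem one_mem_bdd : one U ∈ bdd U := by
  refine mem_bdd_of_iteratedFDeriv _ fun n => ⟨1, fun i z hz => ?_⟩
  have h1 : (one U).val i =ᶠ[𝓝 z] fun _ => 1 :=
    ((U i).isOpen.eventually_mem hz).mono fun y hy => one_apply hy
  rw [(Filter.EventuallyEq.iteratedFDeriv ℝ h1 n).eq_of_nhds]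
  rcases n with _ | n
  · simp
  · rw [iteratedFDeriv_const_of_ne (by simp)]; simp

end Fam

/-- The operator `e · ∇ + h ξ ∂_t`. -/
def dirOp {I : Type} {d : ℕ} (h : bddFun I) (ξ : ℝ) (e : Fin d → ℝ) : DiffOp I d :=
  ∑ l, e l • MvPolynomial.X (some l) + MvPolynomial.C h * (ξ • MvPolynomial.X none)

/-- The displacement over one time step is `(h e, ξ h ^ 2)`, so `h` times `dirOp` is differentiation
along it, as the Taylor expansion requires. -/
theorem dirOp_smul_apply {I : Type} {d : ℕ} {U : I → Opens (Pt d)} (h : bddFun I) (ξ : ℝ)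
    (e : Fin d → ℝ) (u : Fam U) (i : I) (z : Pt d) (hz : z ∈ U i) :
    ((MvPolynomial.C h * dirOp h ξ e) • u).val i z
      = fderiv ℝ (u.val i) z (h.val i • e, ξ * h.val i ^ 2) := by
  have h1 : ((h.val i • e, ξ * h.val i ^ 2) : Pt d)
      = ∑ l, (h.val i * e l) • dir (some l) + (ξ * h.val i ^ 2) • dir none := by
    ext l
    · simp [dir, Prod.fst_sum, Finset.sum_apply, Pi.single_apply]
    · simp [dir, Prod.snd_sum]
  rw [h1, Fam.C_mul_smul_apply, dirOp, add_smul, Fam.add_apply, Finset.sum_smul, Fam.sum_apply,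
    Fam.C_mul_smul_apply, map_add, map_sum]
  simp only [Fam.real_smul_apply, Fam.X_smul, Fam.deriv_apply _ _ hz, map_smul, smul_eq_mul]
  rw [mul_add, Finset.mul_sum]
  congr 1
  · exact Finset.sum_congr rfl fun l _ => by ring
  · ring

/-! ### Monomials and moments of the scheme -/

/-- For `i = j` the monomial is `X_i ^ 3 = X_i`, which is the row relaxed by `s_{x_i}`. First-order
and mixed third-order rows can thus be treated uniformly. -/
theorem exists_idx_odd {d : ℕ} (i j : Fin d) : ∃ m : Idx d,
    (∀ k, mono m k = unitVel k i ^ 2 * unitVel k j) ∧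
    ∀ (P : Params d) (Δx : ℝ), P.relax Δx m = if i = j then P.sx Δx i else P.s3 Δx i j := by
  rcases lt_trichotomy i j with h | rfl | h
  · refine ⟨.inr (.inr (⟨(i, j), h⟩, true, false)), fun k => ?_, fun P Δx => ?_⟩
    · rw [mono, prod_pow_expo]; simp [pw]
    · rw [if_neg h.ne]; rfl
  · refine ⟨.inr (.inl (i, false)), fun k => ?_, fun P Δx => ?_⟩
    · rw [mono, prod_pow_expo, ← pow_succ, unitVel_cube]; simp [pw]
    · rw [if_pos rfl]; rfl
  · refine ⟨.inr (.inr (⟨(j, i), h⟩, false, true)), fun k => ?_, fun P Δx => ?_⟩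
    · rw [mono, prod_pow_expo]; simp [pw, mul_comm]
    · rw [if_neg h.ne']; rfl

theorem exists_idx_sq {d : ℕ} (i : Fin d) : ∃ m : Idx d, (∀ k, mono m k = unitVel k i ^ 2) ∧
    ∀ (P : Params d) (Δx : ℝ), P.relax Δx m = P.s2 s(i, i) := by
  refine ⟨.inr (.inl (i, true)), fun k => ?_, fun P Δx => rfl⟩
  rw [mono, prod_pow_expo]; simp [pw]

theorem exists_idx_mixed {d : ℕ} (i j : Fin d) (hij : i ≠ j) : ∃ m : Idx d,
    (∀ k, mono m k = unitVel k i * unitVel k j) ∧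
    ∀ (P : Params d) (Δx : ℝ), P.relax Δx m = P.s2 s(i, j) := by
  rcases lt_or_gt_of_ne hij with h | h
  · refine ⟨.inr (.inr (⟨(i, j), h⟩, false, false)), fun k => ?_, fun P Δx => rfl⟩
    rw [mono, prod_pow_expo]; simp [pw]
  · refine ⟨.inr (.inr (⟨(j, i), h⟩, false, false)), fun k => ?_, fun P Δx => ?_⟩
    · rw [mono, prod_pow_expo]; simp [pw, mul_comm]
    · rw [Sym2.eq_swap]; rfl

theorem exists_idx_four {d : ℕ} (i j : Fin d) (hij : i ≠ j) : ∃ m : Idx d,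
    (∀ k, mono m k = unitVel k i ^ 2 * unitVel k j ^ 2) ∧
    ∀ (P : Params d) (Δx : ℝ), P.relax Δx m = P.s4 s(i, j) := by
  rcases lt_or_gt_of_ne hij with h | h
  · refine ⟨.inr (.inr (⟨(i, j), h⟩, true, true)), fun k => ?_, fun P Δx => rfl⟩
    rw [mono, prod_pow_expo]; simp [pw]
  · refine ⟨.inr (.inr (⟨(j, i), h⟩, true, true)), fun k => ?_, fun P Δx => ?_⟩
    · rw [mono, prod_pow_expo]; simp [pw, mul_comm]
    · rw [Sym2.eq_swap]; rfl

theorem scheme_moment {d : ℕ} (P : Params d) {Δx : ℝ} (hc : P.speed Δx ≠ 0)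
    (g : Idx d → (Fin d → ℝ) × ℝ → ℝ) (x : Fin d → ℝ) (t : ℝ) (hS : P.SchemeAt Δx g x t)
    (m : Idx d) :
    ∑ k, mono m k * (g k (x + P.dt Δx • P.vel Δx k, t + P.dt Δx) - g k (x, t))
      = -(P.relax Δx m * (∑ k, mono m k * g k (x, t)
          - (∑ k, P.weight k * mono m k) * P.macro_ Δx g (x, t)))
        + P.dt Δx * (1 - P.relax Δx m / 2) * (∑ k, P.weight k * mono m k)
          * (P.η * P.macro_ Δx g (x, t) + P.S) := by
  set φ := P.macro_ Δx g (x, t) with hφ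
  have hv : ∀ v : Idx d → ℝ, ∑ k, mono m k * ∑ i, P.collision Δx k i * v i
      = P.relax Δx m * ∑ i, mono m i * v i := by
    intro v
    simp only [Finset.mul_sum]
    rw [Finset.sum_comm]
    refine Finset.sum_congr rfl fun i _ => ?_
    rw [← mul_assoc, ← sum_mono_mul_collision P Δx hc, Finset.sum_mul]
    exact Finset.sum_congr rfl fun k _ => by ring
  have h1 : ∀ k, g k (x + P.dt Δx • P.vel Δx k, t + P.dt Δx) - g k (x, t)
      = -(∑ i, P.collision Δx k i * (g i (x, t) - P.weight i * φ))
        + P.dt Δx * ((P.weight k - 1 / 2 * ∑ i, P.collision Δx k i * P.weight i)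
          * (P.η * φ + P.S)) := by
    intro k
    rw [hS k, ← hφ]
    have h2 : ∑ i, ((1 : Matrix (Idx d) (Idx d) ℝ) - (1 / 2 : ℝ) • P.collision Δx) k i
        * (P.weight i * (P.η * φ + P.S))
        = (P.weight k - 1 / 2 * ∑ i, P.collision Δx k i * P.weight i) * (P.η * φ + P.S) := by
      simp only [Matrix.sub_apply, Matrix.smul_apply, smul_eq_mul, sub_mul,
        Finset.sum_sub_distrib, Matrix.one_apply, ite_mul, one_mul, zero_mul,
        Finset.sum_ite_eq, Finset.mem_univ, if_true, Finset.mul_sum, Finset.sum_mul]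
      congr 1
      exact Finset.sum_congr rfl fun i _ => by ring
    rw [h2]; ring
  simp only [h1]
  rw [Finset.sum_congr rfl fun k _ => mul_add _ _ _, Finset.sum_add_distrib]
  simp only [mul_neg, Finset.sum_neg_distrib]
  rw [hv]
  have h3 : ∑ k, mono m k * (P.dt Δx * ((P.weight k - 1 / 2 * ∑ i, P.collision Δx k i * P.weight i)
          * (P.η * φ + P.S)))
      = P.dt Δx * (P.η * φ + P.S) * (∑ k, mono m k * P.weight k
        - 1 / 2 * ∑ k, mono m k * ∑ i, P.collision Δx k i * P.weight i) := by
    rw [Finset.mul_sum (a := (1 / 2 : ℝ)), ← Finset.sum_sub_distrib, Finset.mul_sum]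
    exact Finset.sum_congr rfl fun k _ => by ring
  rw [h3, hv]
  have h4 : ∑ i, mono m i * (g i (x, t) - P.weight i * φ)
      = ∑ k, mono m k * g k (x, t) - (∑ k, P.weight k * mono m k) * φ := by
    rw [Finset.sum_mul, ← Finset.sum_sub_distrib]
    exact Finset.sum_congr rfl fun k _ => by ring
  have h5 : ∑ k, mono m k * P.weight k = ∑ k, P.weight k * mono m k :=
    Finset.sum_congr rfl fun k _ => mul_comm _ _
  rw [h4, h5]
  ring

/-! ### The relaxation parameters for small mesh sizes -/

section
variable {d : ℕ} {P : Params d} {h₀ : ℝ}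

theorem dt_pos (hP : P.Admissible h₀) {Δx : ℝ} (h : 0 < Δx) : 0 < P.dt Δx := by
  have := hP.ξ_pos
  rw [Params.dt]; positivity

theorem speed_ne_zero (hP : P.Admissible h₀) {Δx : ℝ} (h : 0 < Δx) : P.speed Δx ≠ 0 :=
  div_ne_zero h.ne' (dt_pos hP h).ne'

/-- The formula in condition (1) is a root of this quadratic in `1 / s_{x_i}`; squaring the root in
`radicand` verifies it. For `η = 0` the correction vanishes. -/
theorem inv_sx_eq (hP : P.Admissible h₀) (h1 : P.Cond1 h₀) {Δx : ℝ} (hx : Δx ∈ Ioo 0 h₀)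
    (i : Fin d) : 1 / P.sx Δx i
      = 1 / P.sxt i + P.dt Δx * P.η * ((1 / P.sx Δx i) ^ 2 - 1 / P.sx Δx i) := by
  obtain ⟨hr, hs⟩ := h1 Δx hx i
  have hsx := (hP.sx_mem Δx hx i).1
  have hst := hP.sxt_ne i
  by_cases hη : P.η = 0
  · rw [if_pos hη] at hs
    rw [hs, hη]; ring
  rw [if_neg hη] at hs
  have hdt := (dt_pos hP hx.1).ne'
  have hq := Real.sq_sqrt hr
  have hq' : √(P.radicand Δx i) ^ 2 * P.sxt i = P.sxt i - 4 * P.dt Δx * P.η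
      + P.dt Δx ^ 2 * P.sxt i * P.η ^ 2 + 2 * P.dt Δx * P.sxt i * P.η := by
    rw [hq, Params.radicand, div_mul_cancel₀ _ hst]
  rw [hs, one_div_div]
  generalize √(P.radicand Δx i) = q at *
  field_simp
  linear_combination -hq'

/-- The explicit formula for `1 / s_{x_i}` is a quotient whose denominator tends to zero.
Multiplying by the conjugate `Δt η + √radicand + 1` gives exactly `2 / s̃_i`, and the conjugate is
at least `1 / 2`. -/
theorem abs_inv_sx_le (hP : P.Admissible h₀) (h1 : P.Cond1 h₀) {Δx : ℝ} (hx : Δx ∈ Ioo 0 h₀)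
    (hη : P.dt Δx * |P.η| ≤ 1 / 2) (i : Fin d) : |1 / P.sx Δx i| ≤ 4 / |P.sxt i| := by
  obtain ⟨hr, hs⟩ := h1 Δx hx i
  have hst := hP.sxt_ne i
  have hst' : 0 < |P.sxt i| := abs_pos.2 hst
  by_cases h0 : P.η = 0
  · rw [if_pos h0] at hs
    rw [hs, abs_div, abs_one]
    gcongr
    norm_num
  rw [if_neg h0] at hs
  have hdt := (dt_pos hP hx.1)
  have hq := Real.sq_sqrt hr
  have hq0 := Real.sqrt_nonneg (P.radicand Δx i)
  have hq' : √(P.radicand Δx i) ^ 2 * P.sxt i = P.sxt i - 4 * P.dt Δx * P.η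
      + P.dt Δx ^ 2 * P.sxt i * P.η ^ 2 + 2 * P.dt Δx * P.sxt i * P.η := by
    rw [hq, Params.radicand, div_mul_cancel₀ _ hst]
  have hy : 1 / P.sx Δx i = (P.dt Δx * P.η - √(P.radicand Δx i) + 1) / (2 * P.η * P.dt Δx) := by
    rw [hs, one_div_div]
  generalize √(P.radicand Δx i) = q at *
  have hτ : -(1 / 2) ≤ P.dt Δx * P.η := by
    have := neg_abs_le (P.dt Δx * P.η)
    rw [abs_mul, abs_of_pos hdt] at this
    linarith
  have hD : 1 / 2 ≤ P.dt Δx * P.η + q + 1 := by linarith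
  have hprod : 1 / P.sx Δx i * (P.dt Δx * P.η + q + 1) = 2 / P.sxt i := by
    rw [hy]
    have := hdt.ne'
    field_simp
    linear_combination -hq'
  have h2 : |1 / P.sx Δx i| * (P.dt Δx * P.η + q + 1) = 2 / |P.sxt i| := by
    rw [← abs_of_pos (by linarith : 0 < P.dt Δx * P.η + q + 1), ← abs_mul, hprod, abs_div]
    simp
  have h3 : |1 / P.sx Δx i| * (1 / 2) ≤ 2 / |P.sxt i| := by
    rw [← h2]; gcongr
  have h4 : 4 / |P.sxt i| = 2 * (2 / |P.sxt i|) := by ring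
  rw [h4]; linarith

theorem exists_relax_bounds (hP : P.Admissible h₀) (i j : Fin d) (hij : i ≠ j) :
    ∃ C, ∀ᶠ Δx in 𝓝[>] (0 : ℝ), |1 / P.s3 Δx i j| ≤ C ∧
      |1 / P.s3 Δx i j - 1 / P.s3t i j| ≤ C * Δx ^ 2 := by
  obtain ⟨c, hc⟩ := (hP.s3_sub i j hij).bound
  have ht := hP.s3t_ne i j hij
  have ht' : 0 < |P.s3t i j| := abs_pos.2 ht
  have hlim : Tendsto (fun Δx : ℝ => c * Δx ^ 2) (𝓝[>] 0) (𝓝 0) := by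
    have : Tendsto (fun Δx : ℝ => c * Δx ^ 2) (𝓝 0) (𝓝 (c * 0 ^ 2)) :=
      (continuous_const.mul (continuous_pow 2)).tendsto 0
    simp only [ne_eq, OfNat.ofNat_ne_zero, not_false_eq_true, zero_pow, mul_zero] at this
    exact this.mono_left nhdsWithin_le_nhds
  refine ⟨max (2 / |P.s3t i j|) (c * (2 / |P.s3t i j| ^ 2)), ?_⟩
  filter_upwards [hc, hlim.eventually_lt_const (half_pos ht'),
    Ioo_mem_nhdsGT hP.h₀_pos] with Δx h1 h2 hx
  have hs := hP.s3_ne Δx hx i j hij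
  simp only [Real.norm_eq_abs, abs_pow, sq_abs] at h1
  -- A lower bound away from zero transfers the `O(Δx²)` estimate from the parameters to their
  -- inverses.
  have h3 : |P.s3t i j| / 2 ≤ |P.s3 Δx i j| := by
    have := abs_sub_abs_le_abs_sub (P.s3t i j) (P.s3 Δx i j)
    rw [abs_sub_comm] at this
    linarith
  have h4 : |1 / P.s3 Δx i j| ≤ 2 / |P.s3t i j| := by
    rw [abs_div, abs_one, div_le_div_iff₀ (abs_pos.2 hs) ht']
    linarith
  refine ⟨h4.trans (le_max_left _ _), ?_⟩
  have h5 : 1 / P.s3 Δx i j - 1 / P.s3t i j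
      = -(P.s3 Δx i j - P.s3t i j) * (1 / P.s3 Δx i j) * (1 / P.s3t i j) := by
    field_simp
    ring
  rw [h5, abs_mul, abs_mul, abs_neg]
  have h6 : |1 / P.s3t i j| = 1 / |P.s3t i j| := by rw [abs_div, abs_one]
  calc |P.s3 Δx i j - P.s3t i j| * |1 / P.s3 Δx i j| * |1 / P.s3t i j|
      ≤ (c * Δx ^ 2) * (2 / |P.s3t i j|) * (1 / |P.s3t i j|) := by
        rw [h6]
        have : 0 ≤ c * Δx ^ 2 := (abs_nonneg _).trans h1
        gcongr
    _ = c * (2 / |P.s3t i j| ^ 2) * Δx ^ 2 := by field_simp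
    _ ≤ _ := by gcongr; exact le_max_right _ _

theorem err0_eq_zero (hP : P.Admissible h₀) (h1 : P.Cond1 h₀) (h2 : P.Cond2) {Δx : ℝ}
    (hx : Δx ∈ Ioo 0 h₀) (i : Fin d) : P.err0 Δx i = 0 := by
  have h3 := h2 i
  have h4 := inv_sx_eq hP h1 hx i
  rw [Params.epst] at h3
  rw [Params.err0, ← h3, div_eq_mul_one_div (P.dt Δx)]
  linear_combination P.A i * h4

end

/-! ### From families of solutions to moment systems -/

/-- Second-order limit of the inverse relaxation parameter of the monomial `X_i² X_j`. -/
def Params.invt {d : ℕ} (P : Params d) (i j : Fin d) : ℝ :=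
  if i = j then 1 / P.sxt i else 1 / P.s3t i j

/-- The moment of the weights given by the monomial `m`. -/
def Params.wmom {d : ℕ} (P : Params d) (m : Idx d) : ℝ := ∑ k, P.weight k * mono m k

/-- A solution of the scheme as a family of smooth functions with bounded derivatives, together
with the translated distribution functions and their Taylor expansions. -/
structure SchemeFam {d : ℕ} (P : Params d) {I : Type} (U : I → Opens (Pt d)) where
  h : bddFun I
  f : Idx d → Fam.bdd U
  g : Idx d → Fam.bdd U
  w : Idx d → Fam.bdd U
  φ : Fam.bdd U
  F : Fam.bdd U
  inv : Fin d → Fin d → bddFun I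
  gr : Fin d → Fin d → bddFun I
  taylor : ∀ k, g k = (∑ n ∈ Finset.range 6, (1 / n.factorial : ℝ) •
    (MvPolynomial.C h * dirOp h P.ξ (unitVel k)) ^ n) • f k
      + (MvPolynomial.C h ^ 6 : DiffOp I d) • w k
  del_F : ∀ i, (MvPolynomial.X (some i) : DiffOp I d) • F
    = (P.η • MvPolynomial.X (some i) : DiffOp I d) • φ
  rel : ∀ (m : Idx d) (y : bddFun I), (∀ i, y.val i * P.relax (h.val i) m = 1) →
    ∑ k, (mono m k • (1 : DiffOp I d)) • f k = (P.wmom m • (1 : DiffOp I d)) • φ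
      + ((P.wmom m * P.ξ) • (MvPolynomial.C h ^ 2 * (MvPolynomial.C y - (1 / 2 : ℝ) • 1)) :
          DiffOp I d) • F
      - (MvPolynomial.C y : DiffOp I d) • ∑ k, (mono m k • (1 : DiffOp I d)) • (g k - f k)
  cons : ∑ k, (g k - f k) = (P.ξ • MvPolynomial.C h ^ 2 : DiffOp I d) • F
  mass : ∑ k, f k = φ - ((P.ξ / 2) • MvPolynomial.C h ^ 2 : DiffOp I d) • F
  inv_mul : ∀ i j x, (inv i j).val x * (if i = j then P.sx (h.val x) i else P.s3 (h.val x) i j) = 1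
  inv_eq : ∀ i j x, (inv i j).val x = P.invt i j + h.val x ^ 2 * (gr i j).val x
  gr_eq : ∀ i x, (gr i i).val x = P.ξ * P.η * ((inv i i).val x ^ 2 - (inv i i).val x)

namespace SchemeFam

variable {d : ℕ} {P : Params d} {I : Type} {U : I → Opens (Pt d)} (A : SchemeFam P U)

/-- The operator `h`. -/
abbrev hop : DiffOp I d := MvPolynomial.C A.h

/-- Bounded families modulo `h ^ 6`. -/
abbrev Quot6 : Type := Fam.bdd U ⧸ LinearMap.range (LinearMap.lsmul (DiffOp I d) (Fam.bdd U) (A.hop ^ 6))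

/-- The projection to bounded families modulo `h ^ 6`. -/
abbrev quo : Fam.bdd U →ₗ[DiffOp I d] A.Quot6 := Submodule.mkQ _

theorem quo_pow_smul (u : Fam.bdd U) : A.quo (A.hop ^ 6 • u) = 0 :=
  (Submodule.Quotient.mk_eq_zero _).2 ⟨u, rfl⟩

/-- The moment functional. -/
def mom : (Idx d → DiffOp I d) →ₗ[DiffOp I d] A.Quot6 :=
  Fintype.linearCombination (DiffOp I d) fun k => A.quo (A.f k)

theorem mom_apply (p : Idx d → DiffOp I d) : A.mom p = A.quo (∑ k, p k • A.f k) := by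
  rw [mom, Fintype.linearCombination_apply, map_sum]
  simp only [map_smul]

/-- The Taylor polynomial of a translation, without the identity. -/
def taylorOp : Idx d → DiffOp I d := fun k =>
  ∑ n ∈ Finset.range 5, (1 / (n + 1).factorial : ℝ) • (A.hop * dirOp A.h P.ξ (unitVel k)) ^ (n + 1)

/-- Modulo `h ^ 6`, translation minus the identity is the Taylor operator. The abstract moments `E
(m * B)` are therefore moments of `g - f`. -/
theorem mom_mul_taylorOp (c : Idx d → DiffOp I d) :
    A.mom (c * A.taylorOp) = A.quo (∑ k, c k • (A.g k - A.f k)) := by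
  rw [mom_apply]
  simp only [map_sum, map_smul, map_sub]
  refine Finset.sum_congr rfl fun k _ => ?_
  have h1 : A.g k = A.f k + A.taylorOp k • A.f k + A.hop ^ 6 • A.w k := by
    rw [A.taylor, Finset.sum_range_succ', taylorOp]
    simp only [pow_zero, Nat.factorial_zero, Nat.cast_one, div_one, one_smul, add_smul]
    abel
  rw [h1, map_add, quo_pow_smul, add_zero, map_add, add_sub_cancel_left, Pi.mul_apply, mul_smul,
    map_smul]

/-- Coordinates on the lattice. -/
def coord (i : Fin d) : Idx d → DiffOp I d := fun k => unitVel k i • 1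

/-- The spatial part of the directional derivatives. -/
def gradOp : Idx d → DiffOp I d := ∑ i, (MvPolynomial.X (some i) : DiffOp I d) • coord i

theorem gradOp_apply (k : Idx d) :
    (gradOp k : DiffOp I d) = ∑ i, unitVel k i • MvPolynomial.X (some i) := by
  rw [gradOp, Finset.sum_apply]
  refine Finset.sum_congr rfl fun i _ => ?_
  simp [coord]

/-- The operator `ξ ∂_t`. -/
def timeOp (P : Params d) : DiffOp I d := P.ξ • MvPolynomial.X none

theorem rel_mom (m : Idx d) (y : bddFun I) (hy : ∀ i, y.val i * P.relax (A.h.val i) m = 1)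
    (p : Idx d → DiffOp I d) (hp : ∀ k, p k = mono m k • 1) :
    A.mom p = (P.wmom m • (1 : DiffOp I d)) • A.quo A.φ
      + ((P.wmom m * P.ξ) • (A.hop ^ 2 * (MvPolynomial.C y - (1 / 2 : ℝ) • 1))) • A.quo A.F
      - (MvPolynomial.C y : DiffOp I d) • A.mom (p * A.taylorOp) := by
  have hp' : p = fun k => mono m k • 1 := funext hp
  rw [mom_mul_taylorOp, mom_apply, hp', A.rel m y hy, map_sub, map_add, map_smul, map_smul,
    map_smul]

/-- A constant as a bounded function. -/
abbrev const (c : ℝ) : bddFun I := algebraMap ℝ (bddFun I) c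

theorem C_const (c : ℝ) : (MvPolynomial.C (const c) : DiffOp I d) = c • 1 := by
  rw [Algebra.smul_def, mul_one]; rfl

theorem const_apply (c : ℝ) (i : I) : (const c).val i = c := rfl

theorem coord_sq_mul (i j : Fin d) (k : Idx d) :
    (coord i ^ 2 * coord j : Idx d → DiffOp I d) k = (unitVel k i ^ 2 * unitVel k j) • 1 := by
  simp only [coord, Pi.mul_apply, Pi.pow_apply]; algebra

/-- The moment system of a solution of the scheme. -/
def toMomentSystem (h2 : ∀ i j, P.s2 s(i, j) ≠ 0) (h4 : ∀ i j, i ≠ j → P.s4 s(i, j) ≠ 0) :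
    MomentSystem d (DiffOp I d) A.Quot6 (Idx d → DiffOp I d) where
  E := A.mom
  X := coord
  h := A.hop
  τ := timeOp P
  del i := MvPolynomial.X (some i)
  φ := A.quo A.φ
  F := A.quo A.F
  ξ := P.ξ
  η := P.η
  g i j := MvPolynomial.C (A.inv i j)
  gt := P.invt
  gr i j := MvPolynomial.C (A.gr i j)
  b i j := 1 / P.s2 s(i, j)
  r4 i j := 1 / P.s4 s(i, j)
  W := P.mom4
  D := gradOp
  B := A.taylorOp
  -- The terms of order at least six in `h` when the powers of `h (D + h τ)` up to the fifth are
  -- expanded, with `h ^ 6` taken out.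
  C := fun k => (1 / 6 : ℝ) • timeOp P ^ 3 + (1 / 24 : ℝ) • (6 * gradOp k ^ 2 * timeOp P ^ 2
      + 4 * A.hop * gradOp k * timeOp P ^ 3 + A.hop ^ 2 * timeOp P ^ 4)
    + (1 / 120 : ℝ) • (5 * gradOp k ^ 4 * timeOp P + 10 * A.hop * gradOp k ^ 3 * timeOp P ^ 2
      + 10 * A.hop ^ 2 * gradOp k ^ 2 * timeOp P ^ 3 + 5 * A.hop ^ 3 * gradOp k * timeOp P ^ 4
      + A.hop ^ 4 * timeOp P ^ 5)
  W_symm i j := by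
    by_cases hij : i = j
    · rw [hij]
    · simp [Params.mom4, hij, Ne.symm hij]
  h6 q := by
    obtain ⟨u, rfl⟩ := Submodule.mkQ_surjective _ q
    rw [← map_smul]; exact A.quo_pow_smul u
  X_cube i := by
    funext k
    have := unitVel_cube k i
    simp only [coord, Pi.pow_apply]
    rw [_root_.smul_pow, this, one_pow]
  X_mul i j l hij hjl hil := by
    funext k
    have := unitVel_mul k i j l hij hjl hil
    simp only [coord, Pi.mul_apply, smul_mul_smul_comm, this, zero_smul, Pi.zero_apply]
  D_eq := rfl
  B_eq := by
    funext k
    have hL : dirOp A.h P.ξ (unitVel k) = gradOp k + A.hop * timeOp P := by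
      rw [dirOp, gradOp_apply, timeOp]
    simp only [taylorOp, hL, Finset.sum_range_succ, Finset.sum_range_zero, Nat.factorial, Pi.add_apply,
      Pi.smul_apply, Pi.pow_apply, Pi.one_apply, smul_eq_mul]
    push_cast
    algebra
  rel_odd i j := by
    obtain ⟨m, hm, hr⟩ := exists_idx_odd i j
    have hw : P.wmom m = 0 := by
      -- The exponent of the coordinate `j` is odd, namely one if `i ≠ j` and three if `i = j`.
      refine sum_weight_eq_zero P j (mono m) fun k => ?_
      simp only [hm, unitVel_reflect]
      split_ifs <;> ring
    rw [A.rel_mom m (A.inv i j) (fun x => by rw [hr]; exact A.inv_mul i j x) _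
      (fun k => by rw [hm, coord_sq_mul]), hw]
    simp
  rel_sq i := by
    obtain ⟨m, hm, hr⟩ := exists_idx_sq i
    have hw : P.wmom m = P.mom4 i i := by
      rw [← sum_weight_sq_mul_sq]
      refine Finset.sum_congr rfl fun k _ => ?_
      have := unitVel_cube k i
      rw [hm]
      linear_combination (-P.weight k * unitVel k i) * this
    rw [A.rel_mom m (const (1 / P.s2 s(i, i)))
      (fun x => by rw [hr, const_apply, one_div_mul_cancel (h2 i i)]) _
      (fun k => by rw [hm]; simp only [coord, Pi.pow_apply, _root_.smul_pow, one_pow]), hw, C_const]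
    match_scalars <;> algebra
  rel_mixed i j hij := by
    obtain ⟨m, hm, hr⟩ := exists_idx_mixed i j hij
    have hw : P.wmom m = 0 := by
      refine sum_weight_eq_zero P j (mono m) fun k => ?_
      simp only [hm, unitVel_reflect, if_neg hij, if_true]
      ring
    rw [A.rel_mom m (const (1 / P.s2 s(i, j)))
      (fun x => by rw [hr, const_apply, one_div_mul_cancel (h2 i j)]) _
      (fun k => by rw [hm]; simp only [coord, Pi.mul_apply, smul_mul_smul_comm, one_mul]),
      hw, C_const]
    simp
  rel_four i j hij := by
    obtain ⟨m, hm, hr⟩ := exists_idx_four i j hij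
    have hw : P.wmom m = P.mom4 i j := by
      rw [← sum_weight_sq_mul_sq]
      exact Finset.sum_congr rfl fun k _ => by rw [hm]
    rw [A.rel_mom m (const (1 / P.s4 s(i, j)))
      (fun x => by rw [hr, const_apply, one_div_mul_cancel (h4 i j hij)]) _
      (fun k => by
        rw [hm]; simp only [coord, Pi.mul_apply, Pi.pow_apply, _root_.smul_pow, smul_mul_smul_comm,
          one_mul, one_pow]), hw, C_const]
    match_scalars <;> algebra
  cons := by
    have := A.mom_mul_taylorOp 1
    simp only [one_mul, Pi.one_apply, one_smul] at this
    rw [this, A.cons, map_smul]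
  mass := by
    rw [mom_apply]
    simp only [Pi.one_apply, one_smul]
    rw [A.mass, map_sub, map_smul]
  g_eq i j := by
    rw [← C_const, ← map_pow, ← map_mul, ← map_add]
    congr 1
    exact bddFun.ext_val fun x => A.inv_eq i j x
  gr_eq i := by
    have : A.gr i i = const (P.ξ * P.η) * (A.inv i i ^ 2 - A.inv i i) :=
      bddFun.ext_val fun x => A.gr_eq i x
    rw [this, map_mul, C_const, map_sub, map_pow, smul_mul_assoc, one_mul]
  del_F i := by
    rw [← map_smul, A.del_F, map_smul]

theorem exists_modified_equation (h2 : ∀ i j, P.s2 s(i, j) ≠ 0)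
    (h4 : ∀ i j, i ≠ j → P.s4 s(i, j) ≠ 0) : ∃ w ∈ Fam.bdd U,
    (A.hop ^ 2 * timeOp P) • A.φ.1
      = (A.hop ^ 2 * ∑ i, ((P.invt i i - 1 / 2) * P.mom4 i i) • MvPolynomial.X (some i) ^ 2) • A.φ.1
      + (P.ξ • A.hop ^ 2) • A.F.1
      + (A.hop ^ 4 * ∑ i, ∑ j, (A.toMomentSystem h2 h4).coef i j
          • (MvPolynomial.X (some i) ^ 2 * MvPolynomial.X (some j) ^ 2)) • A.φ.1
      + A.hop ^ 6 • w := by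
  have h1 := (A.toMomentSystem h2 h4).modified_equation
  change (A.hop ^ 2 * timeOp P) • A.quo A.φ
      = (A.hop ^ 2 * ∑ i, ((P.invt i i - 1 / 2) * P.mom4 i i) • MvPolynomial.X (some i) ^ 2)
        • A.quo A.φ + (P.ξ • A.hop ^ 2) • A.quo A.F
      + (A.hop ^ 4 * ∑ i, ∑ j, (A.toMomentSystem h2 h4).coef i j
          • (MvPolynomial.X (some i) ^ 2 * MvPolynomial.X (some j) ^ 2)) • A.quo A.φ at h1
  simp only [← map_smul, ← map_add] at h1
  -- Equality in the quotient is lifted to an identity of families with an explicit remainder `h ^ 6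
  -- • w`, where `w` is bounded uniformly in the mesh size.
  obtain ⟨w, hw⟩ := (Submodule.Quotient.eq _).1 h1
  refine ⟨w.1, w.2, ?_⟩
  rw [eq_comm, sub_eq_iff_eq_add'] at hw
  exact congrArg Subtype.val hw

end SchemeFam

namespace Fam

variable {I : Type} {d : ℕ} {U : I → Opens (Pt d)}

theorem X_sq_smul_apply (a : Fin d) (u : Fam U) {i : I} {g : Pt d → ℝ}
    (h : ∀ z ∈ U i, u.val i z = g z) : ∀ z ∈ U i,
    ((MvPolynomial.X (some a) ^ 2 : DiffOp I d) • u).val i z = dX a (dX a g) z := by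
  rw [sq, mul_smul]
  exact X_smul_apply_of_eqOn _ _ (X_smul_apply_of_eqOn _ u h)

theorem X_sq_mul_X_sq_smul_apply (a b : Fin d) (u : Fam U) {i : I} {g : Pt d → ℝ}
    (h : ∀ z ∈ U i, u.val i z = g z) : ∀ z ∈ U i,
    ((MvPolynomial.X (some a) ^ 2 * MvPolynomial.X (some b) ^ 2 : DiffOp I d) • u).val i z
      = dX4 a b g z := by
  rw [mul_smul]
  exact X_sq_smul_apply _ _ (X_sq_smul_apply _ u h)

end Fam

/-- The open slab `ℝ^d × (0, T)` as an open set. -/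
def slabOpens (d : ℕ) (T : ℝ) : Opens (Pt d) := ⟨slab d T, isOpen_Ioo.preimage continuous_snd⟩

/-- Viewed as a family with a single member, `φ` is acted on by a commutative polynomial ring. -/
theorem dX4_comm {d : ℕ} {T : ℝ} {φ : Pt d → ℝ} (hφ : ContDiffOn ℝ (⊤ : ℕ∞) φ (slab d T))
    (i j : Fin d) {z : Pt d} (hz : z ∈ slab d T) : dX4 i j φ z = dX4 j i φ z := by
  let u : Fam (fun _ : Unit => slabOpens d T) := Fam.mk' (fun _ => φ) fun _ => hφ
  have hu : ∀ z ∈ slabOpens d T, u.val () z = φ z := fun z hz => Fam.mk'_apply _ _ _ hz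
  rw [← Fam.X_sq_mul_X_sq_smul_apply i j u hu z hz, mul_comm,
    Fam.X_sq_mul_X_sq_smul_apply j i u hu z hz]

/-! ### The truncation error -/

namespace Params

variable {d : ℕ} (P : Params d)

/-- The coefficient of `Δx² / ξ ∂_i² ∂_j²` in the second-order truncation error. -/
def coef (i j : Fin d) : ℝ := -(1 / 2) * (P.epst i * P.epst j)
  + (if i = j then e1 (P.sxt i) (P.s2 s(i, i)) (P.sxt i) * P.A i else
      4 * (e1 (P.sxt i) (P.s2 s(i, i)) (P.s3t i j) + e1 (P.sxt i) (P.s2 s(i, j)) (P.s3t i j)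
        + e1 (P.sxt i) (P.s2 s(i, j)) (P.s3t j i)) * P.wd)
  + e2 (P.sxt i) (P.s2 s(i, i)) * P.epst j * P.A i

variable {P}

/-- Condition (2) replaces each `κ_i` by `epst i / ξ`, so all terms acquire the common factor `1 /
ξ`. -/
theorem err2_eq_sum_coef (hξ : P.ξ ≠ 0) (h2 : P.Cond2) (Δx : ℝ) (φ : Pt d → ℝ) (z : Pt d) :
    P.err2 Δx φ z = Δx ^ 2 / P.ξ * ∑ i, ∑ j, P.coef i j * dX4 i j φ z := by
  have hdiag : ∀ G : Fin d → Fin d → ℝ, ∑ i, G i i = ∑ i, ∑ j, if i = j then G i j else 0 := by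
    intro G
    refine Finset.sum_congr rfl fun i _ => ?_
    rw [Finset.sum_ite_eq]; simp
  rw [err2, hdiag (fun i j => e1 (P.sxt i) (P.s2 s(i, i)) (P.sxt i) * P.A i * dX4 i j φ z),
    hdiag (fun i j => e2 (P.sxt i) (P.s2 s(i, i)) * P.κ j * P.A i * dX4 i j φ z),
    ← mul_one_div (Δx ^ 2), mul_assoc]
  congr 1
  simp only [Finset.mul_sum, ← Finset.sum_add_distrib]
  refine Finset.sum_congr rfl fun i _ => Finset.sum_congr rfl fun j _ => ?_
  rw [coef, h2 i, h2 j]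
  split_ifs
  · field_simp
    ring
  · field_simp
    ring

theorem sum_coef_eq_zero (h3 : P.Cond3) (h4 : P.Cond4) (G : Fin d → Fin d → ℝ)
    (hG : ∀ i j, G i j = G j i) : ∑ i, ∑ j, P.coef i j * G i j = 0 := by
  -- The coefficients need not vanish individually; only their symmetrisation does. The diagonal
  -- case is condition (3) multiplied by `2 A_i`, and the off-diagonal case is condition (4).
  have hc : ∀ i j, P.coef i j + P.coef j i = 0 := by
    have hlt : ∀ i j, i < j → P.coef i j + P.coef j i = 0 := by
      intro i j hij
      have := h4 i j hij
      rw [coef, coef, if_neg hij.ne, if_neg hij.ne', Sym2.eq_swap (a := j) (b := i)]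
      linear_combination -this
    intro i j
    rcases lt_trichotomy i j with h | rfl | h
    · exact hlt i j h
    · have := h3 i
      rw [coef, if_pos rfl]
      have he : P.epst i = (1 / P.sxt i - 1 / 2) * P.A i := rfl
      linear_combination (-2 * P.A i) * this - P.epst i * he
    · rw [add_comm]; exact hlt j i h
  have hs : ∑ i, ∑ j, P.coef i j * G i j = ∑ i, ∑ j, P.coef j i * G i j := by
    rw [Finset.sum_comm]
    refine Finset.sum_congr rfl fun i _ => Finset.sum_congr rfl fun j _ => ?_
    rw [hG]
  have hz : ∑ i, ∑ j, P.coef i j * G i j + ∑ i, ∑ j, P.coef j i * G i j = 0 := by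
    simp only [← Finset.sum_add_distrib, ← add_mul, hc, zero_mul, Finset.sum_const_zero]
  linarith

end Params

theorem coef_toMomentSystem {d : ℕ} {P : Params d} {I : Type} {U : I → Opens (Pt d)}
    (A : SchemeFam P U) (h2 : ∀ i j, P.s2 s(i, j) ≠ 0) (h4 : ∀ i j, i ≠ j → P.s4 s(i, j) ≠ 0)
    (i j : Fin d) : (A.toMomentSystem h2 h4).coef i j = P.coef i j := by
  simp only [MomentSystem.coef, SchemeFam.toMomentSystem, MomentSystem.e2inv, Params.coef, e1, e2,
    Params.epst, offDiag, Params.invt, Params.mom4]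
  by_cases hij : i = j
  · subst hij
    simp only [if_true]
    ring
  · simp only [hij, Ne.symm hij, if_true, if_false]
    ring

/-! ### Solutions of the scheme -/

section
variable {d : ℕ} {P : Params d} {h₀ : ℝ}

/-- Below a common mesh size `H` the bounds hold for all pairs at once, so that the inverse
relaxation parameters qualify as elements of `bddFun`. -/
theorem exists_mesh_bound (hP : P.Admissible h₀) : ∃ H, 0 < H ∧ H ≤ h₀ ∧
    (∀ Δx ∈ Ioo 0 H, P.dt Δx * |P.η| ≤ 1 / 2) ∧
    ∃ C : Fin d → Fin d → ℝ, ∀ Δx ∈ Ioo 0 H, ∀ i j, i ≠ j → |1 / P.s3 Δx i j| ≤ C i j ∧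
      |1 / P.s3 Δx i j - 1 / P.s3t i j| ≤ C i j * Δx ^ 2 := by
  have h1 : ∀ i j, ∃ C, ∀ᶠ Δx in 𝓝[>] (0 : ℝ), i ≠ j → |1 / P.s3 Δx i j| ≤ C ∧
      |1 / P.s3 Δx i j - 1 / P.s3t i j| ≤ C * Δx ^ 2 := by
    intro i j
    by_cases hij : i = j
    · exact ⟨0, .of_forall fun _ h => absurd hij h⟩
    · obtain ⟨C, hC⟩ := exists_relax_bounds hP i j hij
      exact ⟨C, hC.mono fun _ h _ => h⟩
  choose C hC using h1
  have h2 : ∀ᶠ Δx in 𝓝[>] (0 : ℝ), P.dt Δx * |P.η| < 1 / 2 := by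
    have : Tendsto (fun Δx : ℝ => P.dt Δx * |P.η|) (𝓝 0) (𝓝 (P.ξ * 0 ^ 2 * |P.η|)) :=
      ((continuous_const.mul (continuous_pow 2)).mul continuous_const).tendsto 0
    exact (this.mono_left nhdsWithin_le_nhds).eventually_lt_const (by norm_num)
  have h3 := h2.and (eventually_all.2 fun i => eventually_all.2 fun j => hC i j)
  obtain ⟨H, hH, hs⟩ := mem_nhdsGT_iff_exists_Ioo_subset.1 h3
  have hm : ∀ Δx ∈ Ioo 0 (min H h₀), Δx ∈ Ioo 0 H := fun Δx h =>
    ⟨h.1, h.2.trans_le (min_le_left _ _)⟩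
  exact ⟨min H h₀, lt_min hH hP.h₀_pos, min_le_right _ _, fun Δx h => (hs (hm Δx h)).1.le,
    C, fun Δx h => (hs (hm Δx h)).2⟩

theorem dt_smul_vel (hP : P.Admissible h₀) {Δx : ℝ} (h : 0 < Δx) (k : Idx d) :
    P.dt Δx • P.vel Δx k = Δx • unitVel k := by
  rw [Params.vel, Params.speed, smul_smul, mul_div_cancel₀ _ (dt_pos hP h).ne']

/-- The points at which the scheme is applied. -/
def schemeOpens (P : Params d) (H T : ℝ) (x : Ioo (0 : ℝ) H) : Opens (Pt d) :=
  ⟨{z | 0 < z.2 ∧ z.2 + P.dt x.1 < T},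
    (isOpen_lt continuous_const continuous_snd).inter
      (isOpen_lt (continuous_snd.add continuous_const) continuous_const)⟩

theorem exists_schemeFam (hP : P.Admissible h₀) (h1 : P.Cond1 h₀) {T : ℝ}
    {f : ℝ → Idx d → Pt d → ℝ} (hf : P.IsSolutionFamily h₀ T f) {H : ℝ} (hH : H ≤ h₀)
    (hη : ∀ Δx ∈ Ioo 0 H, P.dt Δx * |P.η| ≤ 1 / 2) {C : Fin d → Fin d → ℝ}
    (hC : ∀ Δx ∈ Ioo 0 H, ∀ i j, i ≠ j → |1 / P.s3 Δx i j| ≤ C i j ∧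
      |1 / P.s3 Δx i j - 1 / P.s3t i j| ≤ C i j * Δx ^ 2) :
    ∃ A : SchemeFam P (schemeOpens P H T), (∀ x, A.h.val x = x.1) ∧
      ∀ x, ∀ z ∈ schemeOpens P H T x, A.φ.1.val x z = P.macro_ x.1 (f x.1) z ∧
        A.F.1.val x z = P.η * P.macro_ x.1 (f x.1) z + P.S := by
  have hmem : ∀ x : Ioo (0 : ℝ) H, x.1 ∈ Ioo 0 h₀ := fun x => ⟨x.2.1, x.2.2.trans_le hH⟩
  have hpos : ∀ x : Ioo (0 : ℝ) H, 0 < x.1 := fun x => x.2.1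
  have hdt : ∀ x : Ioo (0 : ℝ) H, 0 < P.dt x.1 := fun x => dt_pos hP x.2.1
  have hden : ∀ x : Ioo (0 : ℝ) H, 3 / 2 ≤ 2 - P.dt x.1 * P.η := fun x => by
    have := le_abs_self (P.dt x.1 * P.η)
    rw [abs_mul, abs_of_pos (hdt x)] at this
    linarith [hη x.1 x.2]
  let h : bddFun (Ioo (0 : ℝ) H) := bddFun.of (fun x => x.1)
    ⟨H, fun x => by rw [abs_of_pos (hpos x)]; exact x.2.2.le⟩
  let den : bddFun (Ioo (0 : ℝ) H) := bddFun.of (fun x => 1 / (2 - P.dt x.1 * P.η))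
    ⟨2 / 3, fun x => by
      rw [abs_of_pos (by have := hden x; positivity), div_le_div_iff₀ (by linarith [hden x]) (by norm_num)]
      linarith [hden x]⟩
  let inv : Fin d → Fin d → bddFun (Ioo (0 : ℝ) H) := fun i j =>
    bddFun.of (fun x => 1 / (if i = j then P.sx x.1 i else P.s3 x.1 i j)) <| by
      by_cases hij : i = j
      · simp only [if_pos hij]
        exact ⟨_, fun x => abs_inv_sx_le hP h1 (hmem x) (hη x.1 x.2) i⟩
      · simp only [if_neg hij]
        exact ⟨_, fun x => (hC x.1 x.2 i j hij).1⟩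
  -- On the diagonal the quadratic relation prescribes the correction. Off the diagonal it is the
  -- difference quotient, bounded by the `O(Δx²)` hypothesis.
  let gr : Fin d → Fin d → bddFun (Ioo (0 : ℝ) H) := fun i j =>
    if hij : i = j then (P.ξ * P.η) • (inv i i ^ 2 - inv i i) else
      bddFun.of (fun x => (1 / P.s3 x.1 i j - 1 / P.s3t i j) / x.1 ^ 2)
        ⟨C i j, fun x => by
          have := pow_pos (hpos x) 2
          rw [abs_div, abs_of_pos this, div_le_iff₀ this]
          exact (hC x.1 x.2 i j hij).2⟩
  have hgr : ∀ i x, (gr i i).val x = P.ξ * P.η * ((inv i i).val x ^ 2 - (inv i i).val x) := by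
    intro i x
    simp only [gr, dif_pos]
    rfl
  let V : Ioo (0 : ℝ) H → Opens (Pt d) := fun _ => slabOpens d T
  let u : Idx d → Fam V := fun k => Fam.mk' (fun x => f x.1 k) fun x => hf.smooth x.1 (hmem x) k
  have hu : ∀ k x, ∀ z ∈ slab d T, (u k).val x z = f x.1 k z := fun k x z hz =>
    Fam.mk'_apply _ _ _ hz
  have hub : ∀ k, u k ∈ Fam.bdd V := by
    intro k
    refine Fam.mem_bdd_of_iteratedFDeriv _ fun n => ?_
    obtain ⟨B, hB⟩ := hf.bounded n
    refine ⟨B, fun x z hz => ?_⟩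
    have h1 : (u k).val x =ᶠ[𝓝 z] f x.1 k :=
      ((V x).isOpen.eventually_mem hz).mono fun y hy => hu k x y hy
    rw [(Filter.EventuallyEq.iteratedFDeriv ℝ h1 n).eq_of_nhds]
    exact hB x.1 (hmem x) k z hz
  let δ : Idx d → Ioo (0 : ℝ) H → Pt d := fun k x => (x.1 • unitVel k, P.ξ * x.1 ^ 2)
  -- The whole segment must stay in the slab, not only its endpoint, because the Taylor estimate
  -- differentiates along it.
  have hδ : ∀ k x, ∀ z ∈ schemeOpens P H T x, ∀ s ∈ Icc (0 : ℝ) 1, z + s • δ k x ∈ V x := by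
    intro k x z hz s hs
    have h2 : 0 < P.ξ * x.1 ^ 2 := hdt x
    have h3 : z.2 + P.ξ * x.1 ^ 2 < T := hz.2
    show z.2 + s * (P.ξ * x.1 ^ 2) ∈ Ioo 0 T
    constructor
    · have := mul_nonneg hs.1 h2.le
      linarith [hz.1]
    · have := mul_le_of_le_one_left h2.le hs.2
      linarith
  have hδ1 : ∀ k x, ∀ z ∈ schemeOpens P H T x, z + δ k x ∈ V x := fun k x z hz => by
    have := hδ k x z hz 1 (by simp)
    rwa [one_smul] at this
  have hδ0 : ∀ x, ∀ z ∈ schemeOpens P H T x, z + 0 ∈ V x := fun x z hz => by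
    have := hδ (.inl ()) x z hz 0 (by simp)
    rwa [zero_smul] at this
  have htaylor := fun k => Fam.shift_eq_taylor (δ k) (hδ k) (hδ1 k) hδ0 h hpos
    (dirOp h P.ξ (unitVel k)) (fun v x z hz => dirOp_smul_apply h P.ξ (unitVel k) v x z hz) 6 (u k)
    (hub k)
  choose w hw htay using htaylor
  let U := schemeOpens P H T
  let ff : Idx d → Fam.bdd U := fun k => ⟨Fam.shift (fun _ => 0) hδ0 (u k), Fam.shift_mem_bdd _ _ (hub k)⟩
  let gg : Idx d → Fam.bdd U := fun k => ⟨Fam.shift (δ k) (hδ1 k) (u k), Fam.shift_mem_bdd _ _ (hub k)⟩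
  let one : Fam.bdd U := ⟨Fam.one U, Fam.one_mem_bdd⟩
  let φ : Fam.bdd U := (MvPolynomial.C den : DiffOp (Ioo (0 : ℝ) H) d) • (((2 : ℝ) • (1 : DiffOp (Ioo (0 : ℝ) H) d)) • ∑ k, ff k
    + (MvPolynomial.C h ^ 2 : DiffOp (Ioo (0 : ℝ) H) d) • ((P.ξ * P.S) • (1 : DiffOp (Ioo (0 : ℝ) H) d)) • one)
  let F : Fam.bdd U := (P.η • (1 : DiffOp (Ioo (0 : ℝ) H) d)) • φ + (P.S • (1 : DiffOp (Ioo (0 : ℝ) H) d)) • one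
  have hff : ∀ k x, ∀ z ∈ U x, (ff k).1.val x z = f x.1 k z := by
    intro k x z hz
    have := hδ0 x z hz
    show (Fam.shift (fun _ => 0) hδ0 (u k)).val x z = _
    rw [Fam.shift_apply _ _ _ hz, hu _ _ _ this, add_zero]
  have hgg : ∀ k x, ∀ z ∈ U x, (gg k).1.val x z
      = f x.1 k (z.1 + P.dt x.1 • P.vel x.1 k, z.2 + P.dt x.1) := by
    intro k x z hz
    show (Fam.shift (δ k) (hδ1 k) (u k)).val x z = _
    rw [Fam.shift_apply _ _ _ hz, hu _ _ _ (hδ1 k x z hz), dt_smul_vel hP (hpos x)]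
    rfl
  have hφ : ∀ x, ∀ z ∈ U x, φ.1.val x z = P.macro_ x.1 (f x.1) z := by
    intro x z hz
    simp only [φ, one, Submodule.coe_smul, Submodule.coe_add, Submodule.coe_sum, Fam.C_smul_apply,
      Fam.add_apply, Fam.real_smul_apply, one_smul, Fam.sum_apply, Fam.C_pow_smul_apply,
      Fam.one_apply hz, Params.macro_, hff _ x z hz]
    simp only [den, h, bddFun.of_val, Params.dt]
    ring
  have hF : ∀ x, ∀ z ∈ U x, F.1.val x z = P.η * P.macro_ x.1 (f x.1) z + P.S := by
    intro x z hz
    simp only [F, one, Submodule.coe_smul, Submodule.coe_add, Fam.add_apply, Fam.real_smul_apply,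
      one_smul, Fam.one_apply hz, hφ x z hz, mul_one]
  have hmass : ∀ (x : Ioo (0 : ℝ) H) (z : Pt d), ∑ k, f x.1 k z = P.macro_ x.1 (f x.1) z
      - P.ξ / 2 * x.1 ^ 2 * (P.η * P.macro_ x.1 (f x.1) z + P.S) := by
    intro x z
    have h3 := hden x
    simp only [Params.macro_, Params.dt] at h3 ⊢
    have h4 : 2 - P.ξ * x.1 ^ 2 * P.η ≠ 0 := by linarith
    field_simp
    ring
  have hmom : ∀ (m : Idx d) x, ∀ z ∈ U x, _ := fun m x z hz =>
    scheme_moment P (speed_ne_zero hP (hpos x)) (f x.1) z.1 z.2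
      (hf.scheme x.1 (hmem x) z.1 z.2 hz.1 hz.2) m
  refine ⟨{
    h := h, f := ff, g := gg, w := fun k => ⟨w k, hw k⟩, φ := φ, F := F, inv := inv, gr := gr
    taylor := fun k => Subtype.ext (htay k)
    del_F := ?_
    rel := ?_
    cons := ?_
    mass := ?_
    inv_mul := ?_
    inv_eq := ?_
    gr_eq := ?_ }, fun x => rfl, fun x z hz => ⟨hφ x z hz, hF x z hz⟩⟩
  · intro i
    have h3 : (MvPolynomial.X (some i) : DiffOp (Ioo (0 : ℝ) H) d) • one = 0 := Subtype.ext (Fam.X_smul_one _)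
    simp only [F]
    rw [smul_add, smul_comm _ _ one, h3, smul_zero, add_zero, smul_smul]
    congr 1
    algebra
  · intro m y hy
    refine Subtype.ext (Fam.ext_on fun x z hz => ?_)
    have h3 := hmom m x z hz
    have h4 : y.val x * P.relax x.1 m = 1 := hy x
    simp only [Submodule.coe_smul, Submodule.coe_add, Submodule.coe_sub, Submodule.coe_sum,
      Fam.C_smul_apply, sub_smul, Fam.sub_apply,
      Fam.add_apply, Fam.real_smul_apply, one_smul, Fam.sum_apply, Fam.C_pow_smul_apply,
      mul_smul, hφ x z hz, hF x z hz, hff _ x z hz, hgg _ x z hz]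
    simp only [h, bddFun.of_val, Params.wmom]
    rw [h3, Params.dt]
    linear_combination ((∑ k, P.weight k * mono m k) * (P.macro_ x.1 (f x.1) z
      - P.ξ * x.1 ^ 2 / 2 * (P.η * P.macro_ x.1 (f x.1) z + P.S))
      - ∑ k, mono m k * f x.1 k z) * h4
  · refine Subtype.ext (Fam.ext_on fun x z hz => ?_)
    -- In the zeroth moment `s_0` cancels: the half-step source in the definition of the macroscopic
    -- variable compensates the factor `1 - s_0 / 2`.
    have h3 := hmom (.inl ()) x z hz
    simp only [mono_one, one_mul, mul_one, sum_weight] at h3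
    simp only [Submodule.coe_smul, Submodule.coe_sub, Submodule.coe_sum, Fam.sub_apply,
      Fam.real_smul_apply, Fam.sum_apply, Fam.C_pow_smul_apply, hF x z hz, hff _ x z hz,
      hgg _ x z hz]
    rw [h3, hmass]
    simp only [h, bddFun.of_val, Params.dt]
    ring
  · refine Subtype.ext (Fam.ext_on fun x z hz => ?_)
    simp only [Submodule.coe_smul, Submodule.coe_sub, Submodule.coe_sum,
      Fam.sub_apply, Fam.real_smul_apply, Fam.sum_apply, Fam.C_pow_smul_apply,
      hφ x z hz, hF x z hz, hff _ x z hz, hmass]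
    simp only [h, bddFun.of_val]
    ring
  · intro i j x
    refine one_div_mul_cancel ?_
    split_ifs with hij
    · exact (hP.sx_mem x.1 (hmem x) i).1.ne'
    · exact hP.s3_ne x.1 (hmem x) i j hij
  · intro i j x
    by_cases hij : i = j
    · subst hij
      have h3 := inv_sx_eq hP h1 (hmem x) i
      have h4 : (inv i i).val x = 1 / P.sx x.1 i := by simp only [inv, bddFun.of_val, if_true]
      rw [h4, hgr, h4]
      simp only [h, bddFun.of_val, Params.invt, if_true]
      rw [Params.dt] at h3
      linear_combination h3
    · have h3 := (hpos x).ne'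
      simp only [inv, gr, h, bddFun.of_val, Params.invt, if_neg hij, dif_neg hij]
      field_simp
      ring
  · exact hgr

/-! ### The modified equation and fourth-order consistency -/

theorem hasModifiedEquation_truncation (hP : P.Admissible h₀) (h1 : P.Cond1 h₀) (h2 : P.Cond2) :
    P.HasModifiedEquation h₀ P.truncation := by
  intro T f hf
  obtain ⟨H, hH, hHh, hη, C, hC⟩ := exists_mesh_bound hP
  obtain ⟨A, hAh, hA⟩ := exists_schemeFam hP h1 hf hHh hη hC
  obtain ⟨w, hw, e⟩ := A.exists_modified_equation hP.s2_ne hP.s4_ne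
  -- Only the bound on `w` itself is needed here, hence the trivial operator `1`.
  obtain ⟨B, hB⟩ := hw 1
  refine ⟨B / P.ξ, ?_⟩
  filter_upwards [Ioo_mem_nhdsGT hH] with Δx hx y t ht htT
  have hξ := hP.ξ_pos
  let i : Ioo (0 : ℝ) H := ⟨Δx, hx⟩
  have hz : ((y, t) : Pt d) ∈ schemeOpens P H T i := ⟨ht, htT⟩
  set φ := P.macro_ Δx (f Δx) with hφ
  have hu : ∀ z ∈ schemeOpens P H T i, A.φ.1.val i z = φ z := fun z hz => (hA i z hz).1
  have hh : A.h.val i = Δx := hAh i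
  have h3 := congrArg (fun u => Fam.val u i (y, t)) e
  simp only [mul_smul, Fam.add_apply, Fam.C_pow_smul_apply, SchemeFam.timeOp, Fam.real_smul_apply,
    Finset.sum_smul, Fam.sum_apply, Fam.X_smul_apply_of_eqOn none _ hu _ hz,
    Fam.X_sq_smul_apply _ _ hu _ hz, Fam.X_sq_smul_apply _ _ (Fam.X_sq_smul_apply _ _ hu) _ hz,
    hh, (hA i _ hz).2, coef_toMomentSystem] at h3
  have hκ : ∀ a c, (P.invt a a - 1 / 2) * (P.mom4 a a * c) = P.κ a * P.ξ * c := by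
    intro a c
    rw [← h2 a, ← mul_assoc]
    simp only [Params.invt, Params.mom4, Params.epst, if_true]
  simp only [hκ] at h3
  have h4 : P.residual φ (y, t) - P.truncation Δx φ (y, t) = w.val i (y, t) / P.ξ * Δx ^ 4 := by
    have hx0 := hx.1.ne'
    have h5 : ∑ a, P.κ a * P.ξ * dX a (dX a φ) (y, t) = P.ξ * ∑ a, P.κ a * dX a (dX a φ) (y, t) := by
      rw [Finset.mul_sum]
      exact Finset.sum_congr rfl fun a _ => by ring
    have h6 : dT φ (y, t) = fderiv ℝ φ (y, t) (dir none) := rfl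
    simp only [Params.residual, Params.truncation, Params.err2_eq_sum_coef hξ.ne' h2,
      err0_eq_zero hP h1 h2 ⟨hx.1, hx.2.trans_le hHh⟩, zero_mul, Finset.sum_const_zero, mul_zero,
      zero_add, h6, dX4]
    rw [h5] at h3
    field_simp
    -- The expansion holds after multiplication by `Δx ^ 2`; cancelling this factor turns the
    -- remainder of order `Δx ^ 6` into one of order `Δx ^ 4`.
    refine mul_left_cancel₀ (pow_ne_zero 2 hx0) ?_
    linear_combination h3
  have h8 := hB i (y, t)
  rw [one_smul] at h8
  rw [h4, abs_mul, abs_div, abs_of_pos hξ, abs_of_nonneg (by positivity : 0 ≤ Δx ^ 4)]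
  gcongr

theorem err2_eq_zero (hξ : P.ξ ≠ 0) (h2 : P.Cond2) (h3 : P.Cond3) (h4 : P.Cond4) {T Δx : ℝ}
    {φ : Pt d → ℝ} (hφ : ContDiffOn ℝ (⊤ : ℕ∞) φ (slab d T)) {z : Pt d} (hz : z ∈ slab d T) :
    P.err2 Δx φ z = 0 := by
  rw [Params.err2_eq_sum_coef hξ h2,
    Params.sum_coef_eq_zero h3 h4 (fun i j => dX4 i j φ z) fun i j => dX4_comm hφ i j hz, mul_zero]

theorem fourthOrderConsistent (hP : P.Admissible h₀) (h1 : P.Cond1 h₀) (h2 : P.Cond2)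
    (h3 : P.Cond3) (h4 : P.Cond4) : P.FourthOrderConsistent h₀ := by
  intro T f hf
  obtain ⟨C, hC⟩ := hasModifiedEquation_truncation hP h1 h2 T f hf
  refine ⟨C, ?_⟩
  filter_upwards [hC, Ioo_mem_nhdsGT hP.h₀_pos] with Δx h hx y t ht htT
  have hφ : ContDiffOn ℝ (⊤ : ℕ∞) (P.macro_ Δx (f Δx)) (slab d T) :=
    ((contDiffOn_const.mul (ContDiffOn.sum fun k _ => hf.smooth Δx hx k)).add
      contDiffOn_const).div_const _
  have hz : ((y, t) : Pt d) ∈ slab d T := ⟨ht, by linarith [dt_pos hP hx.1]⟩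
  have h5 := h y t ht htT
  simpa only [Params.truncation, err0_eq_zero hP h1 h2 hx, zero_mul, Finset.sum_const_zero,
    mul_zero, zero_add, err2_eq_zero hP.ξ_pos.ne' h2 h3 h4 hφ hz] using h5

end

end LBM

end

theorem mainTheorem1 (d : ℕ) (hd : 1 ≤ d) (P : LBM.Params d) (h₀ : ℝ)
    (hP : P.Admissible h₀) (h1 : P.Cond1 h₀) (h2 : P.Cond2) :
    ((∀ Δx ∈ Set.Ioo 0 h₀, ∀ i, P.err0 Δx i = 0) ∧ P.HasModifiedEquation h₀ P.truncation) ∧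
    (P.Cond3 → P.Cond4 →
      (∀ (T Δx : ℝ) (φ : (Fin d → ℝ) × ℝ → ℝ), ContDiffOn ℝ (⊤ : ℕ∞) φ (LBM.slab d T) →
        ∀ z ∈ LBM.slab d T, P.err2 Δx φ z = 0) ∧
      P.FourthOrderConsistent h₀) :=
  ⟨⟨fun _ hx i => LBM.err0_eq_zero hP h1 h2 hx i, LBM.hasModifiedEquation_truncation hP h1 h2⟩,
    fun h3 h4 => ⟨fun _ _ _ hφ _ hz => LBM.err2_eq_zero hP.ξ_pos.ne' h2 h3 h4 hφ hz,
      LBM.fourthOrderConsistent hP h1 h2 h3 h4⟩⟩
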